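/- **Setting.** A multigraph $G=(V,E,s)$ is a finite simple graph $(V,E)$, $|V|=n$, with a multiplicity $s_i\in\{1,2,\dots\}$ for each $i\in E$; each underlying edge $i$ stands for $s_i$ parallel (distinguished) edges of $G$. Let $t(G)$ be the number of spanning trees of $G$, and $G\setminus e$ the multigraph obtained by deleting the single edge $e$. For connected $G$, the spanning connectivity game (SCG) of $G$ has the edges of $G$ (all parallel copies) as players, and $v(S)=1$ if $S$ contains the edge set of a spanning tree of $G$, $v(S)=0$ otherwise. Let $W^m$ be the set of minimal winning coalitions (those $S$ with $v(S)=1$ and $v(T)=0$ for all $T\subsetneq S$), and $M_e=\{S\in W^m: e\in S\}$. The Holler value of $e$ is $|M_e|$, its Holler index is $H_e=|M_e|/\sum_f|M_f|$, and its Deegan–Packel index is $D_e=\frac1{|W^m|}\sum_{S\in M_e}\frac1{|S|}$. An edge $e$ is a bridge if $G\setminus e$ is disconnected. **Proposition.** Let $G$ be a connected multigraph with $n$ vertices. 1. Every cofactor of the Laplacian matrix of $G$ (degree matrix minus adjacency matrix, counted with multiplicities) equals $t(G)$. 2. For every edge $e$ of $G$, the Holler value of $e$ is $t(G)$ if $e$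 is a bridge, and $t(G)-t(G\setminus e)$ otherwise. 3. Every minimal winning coalition of the SCG of $G$ has exactly $n-1$ edges, and $H_e=D_e$ for every edge $e$. 4. Each of the following can be computed in polynomial time for a given connected multigraph $G$: the number $t(G)$ together with the numbers $t(G\setminus e)$; the Holler values; the Holler indices; the Deegan–Packel indices (in each case for all edges $e$). In 4, $G$ is given by $n$, the list of its underlying edges and their multiplicities, all numbers in binary. Parallel edges have equal values, and the output lists one value for each underlying edge $i$, which is the value of each of the $s_i$ edges over $i$; indices are output as a numerator and a positive denominator. Polynomial time means: there is one program for a random access machine over the integers (with $+,-,\times$ and integer division) which on every input halts with the correct output at a logarithmic cost (every integer computed, read or used as an address is charged its bit length) that is at most a fixed polynomial in the bit length of the input. -/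

import Mathlib

/-! ### Simple games and power indices

A game on the player set `N` is given by its characteristic function `v : Finset N → ℕ`
(with values 0 and 1); a coalition `S` is winning when `v S = 1` and losing when `v S = 0`. -/

namespace Game

variable {N : Type*} [Fintype N]

/-- A minimal winning coalition: winning, with every proper subset losing. -/
def IsMinimalWinning {N : Type*} (v : Finset N → ℕ) (S : Finset N) : Prop :=
  v S = 1 ∧ ∀ T, T ⊂ S → v T = 0

open Classical in
/-- The set of the minimal winning coalitions. -/
noncomputable def minimalWinning (v : Finset N → ℕ) : Finset (Finset N) :=
  Finset.univ.filter fun S => IsMinimalWinning v S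

open Classical in
/-- The minimal winning coalitions that contain player `i`. -/
noncomputable def minimalWinningWith (v : Finset N → ℕ) (i : N) : Finset (Finset N) :=
  (minimalWinning v).filter fun S => i ∈ S

/-- The Holler value: the number of minimal winning coalitions that contain `i`. -/
noncomputable def hollerValue (v : Finset N → ℕ) (i : N) : ℕ :=
  (minimalWinningWith v i).card

/-- The Holler index (public good index). -/
noncomputable def hollerIndex (v : Finset N → ℕ) (i : N) : ℚ :=
  (hollerValue v i : ℚ) / ∑ j, (hollerValue v j : ℚ)

/-- The Deegan-Packel index. -/
noncomputable def deeganPackelIndex (v : Finset N → ℕ) (i : N) : ℚ :=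
  (1 / ((minimalWinning v).card : ℚ)) * ∑ S ∈ minimalWinningWith v i, 1 / (S.card : ℚ)

end Game

/-! ### Multigraphs and spanning connectivity games -/

/-- A multigraph: a simple underlying graph together with a positive multiplicity for each of
its edges. The multiplicity function is extended by `0` to the pairs that are not edges. -/
structure Multigraph (V : Type*) where
  graph : SimpleGraph V
  mult : Sym2 V → ℕ
  mult_pos_iff : ∀ x, 0 < mult x ↔ x ∈ graph.edgeSet

namespace Multigraph

variable {V : Type*}

/-- The edges of the multigraph: `⟨x, k⟩` is the `k`-th of the `mult x` parallel edges over the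
underlying edge `x`. -/
abbrev Edge (G : Multigraph V) : Type _ := Σ x : Sym2 V, Fin (G.mult x)

def Connected (G : Multigraph V) : Prop := G.graph.Connected

/-- `(V, T)` is a spanning tree of `G`: no two edges of `T` are parallel, and the simple graph
with the edges of `T` is a tree on the whole of `V`. -/
def IsSpanningTree (G : Multigraph V) (T : Finset G.Edge) : Prop :=
  Set.InjOn (fun e : G.Edge => e.1) (T : Set G.Edge) ∧
    (SimpleGraph.fromEdgeSet ((fun e : G.Edge => e.1) '' (T : Set G.Edge))).IsTree

open Classical in
/-- The characteristic function of the spanning connectivity game of `G`, whose players are the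
edges of `G`. -/
noncomputable def scg (G : Multigraph V) (S : Finset G.Edge) : ℕ :=
  if ∃ T : Finset G.Edge, G.IsSpanningTree T ∧ T ⊆ S then 1 else 0

open Classical in
/-- `t(G)`, the number of spanning trees (parallel edges being distinguished). -/
noncomputable def treeCount [Fintype V] [DecidableEq V] (G : Multigraph V) : ℕ :=
  (Finset.univ.filter fun T : Finset G.Edge => G.IsSpanningTree T).card

/-- `G ∖ e`: one of the parallel edges over `e.1` is removed; the underlying edge `e.1`
disappears when `e` was the only one. -/
def deleteEdge [DecidableEq V] (G : Multigraph V) (e : G.Edge) : Multigraph V where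
  graph := SimpleGraph.fromEdgeSet {x | 0 < Function.update G.mult e.1 (G.mult e.1 - 1) x}
  mult := Function.update G.mult e.1 (G.mult e.1 - 1)
  mult_pos_iff := by
    intro x
    rw [SimpleGraph.edgeSet_fromEdgeSet]
    refine ⟨fun h => ⟨h, fun hd => ?_⟩, fun h => h.1⟩
    refine G.graph.not_isDiag_of_mem_edgeSet ((G.mult_pos_iff x).1 ?_) hd
    by_cases hx : x = e.1
    · subst hx
      rw [Function.update_self] at h
      omega
    · rwa [Function.update_of_ne hx] at h

/-- An edge of a (connected) multigraph whose removal disconnects the multigraph. -/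
def IsBridge [DecidableEq V] (G : Multigraph V) (e : G.Edge) : Prop :=
  ¬ (G.deleteEdge e).Connected

/-- The Laplacian matrix: the degree matrix minus the adjacency matrix. -/
def laplacian [Fintype V] [DecidableEq V] (G : Multigraph V) : Matrix V V ℤ :=
  Matrix.diagonal (fun u => ∑ w, (G.mult s(u, w) : ℤ)) -
    Matrix.of fun u w => (G.mult s(u, w) : ℤ)

end Multigraph

/-! ### Random access machines with logarithmic cost

Programs work on a memory of integer registers that are grouped into arrays (a program mentions
finitely many arrays, and array names are fixed in the program; indices inside an array are
computed). Every integer that is computed, read or used as an address is charged its bit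
length. -/

namespace RAM

/-- `σ a i` is the content of cell `i` of array `a`. -/
abbrev State : Type := ℕ → ℕ → ℤ

/-- Length of the binary notation of an integer, with a sign bit (so it is at least 1). -/
def bitLen (z : ℤ) : ℕ := Nat.size z.natAbs + 1

inductive Op where
  | add | sub | mul | div

/-- Integer division rounds so that the remainder is nonnegative; `z / 0 = 0`. -/
def Op.eval : Op → ℤ → ℤ → ℤ
  | .add, x, y => x + y
  | .sub, x, y => x - y
  | .mul, x, y => x * y
  | .div, x, y => x / y

/-- Arithmetic expressions: constants, array access `a[i]`, and the four operations. -/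
inductive Exp where
  | const (c : ℤ)
  | get (a : ℕ) (i : Exp)
  | op (o : Op) (x y : Exp)

/-- The value of an expression. A negative address is read as address 0. -/
def Exp.eval (σ : State) : Exp → ℤ
  | .const c => c
  | .get a i => σ a (i.eval σ).toNat
  | .op o x y => o.eval (x.eval σ) (y.eval σ)

/-- The cost of an evaluation: the total bit length of the values of all subexpressions. -/
def Exp.cost (σ : State) : Exp → ℕ
  | .const c => bitLen c
  | .get a i => i.cost σ + bitLen (σ a (i.eval σ).toNat)
  | .op o x y => x.cost σ + y.cost σ + bitLen (o.eval (x.eval σ) (y.eval σ))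

/-- Programs. Tests ask whether the value of an expression is positive. -/
inductive Prog where
  | skip
  | assign (a : ℕ) (i x : Exp)
  | seq (p q : Prog)
  | ifPos (b : Exp) (p q : Prog)
  | whilePos (b : Exp) (p : Prog)

/-- `σ` after the assignment `a[i] := z`. -/
def State.write (σ : State) (a i : ℕ) (z : ℤ) : State :=
  Function.update σ a (Function.update (σ a) i z)

/-- `Exec p σ τ t`: started in memory `σ`, the program `p` halts in memory `τ` after a
computation of logarithmic cost `t`. -/
inductive Exec : Prog → State → State → ℕ → Prop where
  | skip (σ : State) : Exec .skip σ σ 1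
  | assign (σ : State) (a : ℕ) (i x : Exp) :
      Exec (.assign a i x) σ (σ.write a (i.eval σ).toNat (x.eval σ)) (i.cost σ + x.cost σ + 1)
  | seq {p q : Prog} {σ τ ρ : State} {s t : ℕ} :
      Exec p σ τ s → Exec q τ ρ t → Exec (.seq p q) σ ρ (s + t + 1)
  | ifTrue {b : Exp} {p q : Prog} {σ τ : State} {t : ℕ} :
      0 < b.eval σ → Exec p σ τ t → Exec (.ifPos b p q) σ τ (b.cost σ + t + 1)
  | ifFalse {b : Exp} {p q : Prog} {σ τ : State} {t : ℕ} :
      ¬ 0 < b.eval σ → Exec q σ τ t → Exec (.ifPos b p q) σ τ (b.cost σ + t + 1)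
  | whileTrue {b : Exp} {p : Prog} {σ τ ρ : State} {s t : ℕ} :
      0 < b.eval σ → Exec p σ τ s → Exec (.whilePos b p) τ ρ t →
      Exec (.whilePos b p) σ ρ (b.cost σ + s + t + 1)
  | whileFalse {b : Exp} {p : Prog} {σ : State} :
      ¬ 0 < b.eval σ → Exec (.whilePos b p) σ σ (b.cost σ + 1)

/-- A computational problem is given by its instances, their encoding as an initial memory,
their size, and the condition that the final memory holds a correct answer. It is solvable in
polynomial time if a single program answers every instance correctly, with a cost that is
bounded by a polynomial in the size. -/
def SolvableInPolyTime {I : Type*} (input : I → State) (size : I → ℕ)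
    (correct : I → State → Prop) : Prop :=
  ∃ (p : Prog) (b : Polynomial ℕ), ∀ x : I, ∃ (τ : State) (t : ℕ),
    Exec p (input x) τ t ∧ t ≤ b.eval (size x) ∧ correct x τ

end RAM

/-! ### The computational problems -/

/-- An instance: a connected multigraph with vertices `0, …, n-1`, presented by a list of its
`m` underlying edges `{src j, tgt j}`, in any order and without repetition, together with their
multiplicities. -/
structure SCGInstance where
  n : ℕ
  m : ℕ
  G : Multigraph (Fin n)
  connected : G.Connected
  src : Fin m → Fin n
  tgt : Fin m → Fin n
  enum : Set.BijOn (fun j => s(src j, tgt j)) Set.univ G.graph.edgeSet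

namespace SCGInstance

/-- The `j`-th underlying edge. -/
def pair (x : SCGInstance) (j : Fin x.m) : Sym2 (Fin x.n) := s(x.src j, x.tgt j)

/-- Array 0 holds `n` and `m`; arrays 1, 2, 3 hold the ends and the multiplicities of the
underlying edges; all the other cells are 0. -/
def input (x : SCGInstance) : RAM.State
  | 0, 0 => x.n
  | 0, 1 => x.m
  | 1, j => if h : j < x.m then ((x.src ⟨j, h⟩ : ℕ) : ℤ) else 0
  | 2, j => if h : j < x.m then ((x.tgt ⟨j, h⟩ : ℕ) : ℤ) else 0
  | 3, j => if h : j < x.m then (x.G.mult (x.pair ⟨j, h⟩) : ℤ) else 0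
  | _, _ => 0

/-- The number of bits of the input (multiplicities, like all numbers, are in binary). -/
def size (x : SCGInstance) : ℕ :=
  RAM.bitLen x.n + RAM.bitLen x.m +
    ∑ j : Fin x.m, (RAM.bitLen (x.src j : ℕ) + RAM.bitLen (x.tgt j : ℕ) +
      RAM.bitLen (x.G.mult (x.pair j)))

/-- Cell 0 of array 4 holds `t(G)`, and cell `j` of array 5 holds `t(G ∖ e)` for every edge `e`
over the `j`-th underlying edge. -/
def TreeCountsIn (x : SCGInstance) (τ : RAM.State) : Prop :=
  τ 4 0 = x.G.treeCount ∧
    ∀ (j : Fin x.m) (k : Fin (x.G.mult (x.pair j))),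
      τ 5 j = (x.G.deleteEdge ⟨x.pair j, k⟩).treeCount

/-- Cell `j` of array 4 holds the integer `f e` for every edge `e` over the `j`-th underlying
edge. -/
def ValuesIn (x : SCGInstance) (f : x.G.Edge → ℕ) (τ : RAM.State) : Prop :=
  ∀ (j : Fin x.m) (k : Fin (x.G.mult (x.pair j))), τ 4 j = f ⟨x.pair j, k⟩

/-- Cells `j` of arrays 4 and 5 hold a numerator and a positive denominator of the rational
`f e`, for every edge `e` over the `j`-th underlying edge. -/
def RationalsIn (x : SCGInstance) (f : x.G.Edge → ℚ) (τ : RAM.State) : Prop :=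
  ∀ (j : Fin x.m) (k : Fin (x.G.mult (x.pair j))),
    0 < τ 5 j ∧ f ⟨x.pair j, k⟩ = (τ 4 j : ℚ) / (τ 5 j : ℚ)

end SCGInstance

/-! Games. A winning coalition contains a spanning tree, and spanning trees all have n - 1 edges, so
none properly contains another: minimal winning coalitions are exactly spanning trees
(`isMinimalWinning_scg_iff`). The trees avoiding e are the trees of G ∖ e (`treeCount_deleteEdge`),
so the Holler value plus t(G ∖ e) is t(G), and t(G ∖ e) = 0 for a bridge. As all trees have the same
size, both indices equal the Holler value divided by t(G)(n - 1).

Matrix-tree theorem. The Laplacian is L = B Bᵀ for the signed incidence matrix B with one column per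
parallel edge. With an extra column for a root r, the determinant of the product is the cofactor of
L at (r, r). Cauchy–Binet (`Matrix.factorial_mul_det_mul`) expands it into squares of minors, which
are 1 for the root column together with a spanning tree and 0 otherwise. The other cofactors agree
because the columns of the adjugate lie in the kernel of L, which for connected G consists of
constant vectors.

Algorithm. Fraction-free elimination (`borderedMinor_succ`) keeps every entry a minor of the integer
input matrix, hence of polynomial bit length, but it divides by leading minors. For G ∖ e these may
vanish, so the multiplicity of e is raised instead: L + bbᵀ, with b the incidence vector of e, is
positive definite on vectors that vanish at some vertex, so all leading minors of order below n are
nonzero (`Multigraph.leadingMinor_laplacian_ne_zero`). The minor of L + c bbᵀ is affine in c, with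
values t(G ∖ e) at c = -1 and t(G) at c = 0; its value at c = 1 is therefore 2t(G) - t(G ∖ e). From
this minor and t(G) all outputs follow. The program fills tables with polynomially many entries by
loops of a single kind (`RAM.exec_fill`). -/

/-! ### Cauchy–Binet and rank one perturbations -/

-- Cauchy–Binet over all functions instead of subsets: functions that are not injective contribute
-- 0, and each subset is met once for every ordering, whence the factorial. No order on the indices
-- is needed.
open Matrix in
theorem Matrix.factorial_mul_det_mul {m ι R : Type*} [Fintype m] [DecidableEq m] [Fintype ι]
    [DecidableEq ι] [CommRing R] (M : Matrix m ι R) (N : Matrix ι m R) :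
    ((Fintype.card m).factorial : R) * (M * N).det =
      ∑ f : m → ι, (M.submatrix id f).det * (N.submatrix f id).det := by
  -- Expanding the rows of the product gives the case of the identity; permuting f by σ changes the
  -- second determinant by the sign of σ. Summing over σ then assembles the Leibniz formula for the
  -- first determinant.
  have key : ∀ σ : Equiv.Perm m, ∑ f : m → ι,
      ((Equiv.Perm.sign σ : ℤ) : R) * (∏ i, M (σ i) (f i)) * (N.submatrix f id).det =
        (M * N).det := by
    intro σ
    have h1 : (M * N).det = ∑ f : m → ι, (∏ i, M i (f i)) * (N.submatrix f id).det := by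
      have : (M * N) = fun i => ∑ e, M i e • N e := by
        ext i j
        simp [Matrix.mul_apply, Finset.sum_apply]
      rw [this]
      change Matrix.detRowAlternating (fun i => ∑ e, M i e • N e) = _
      rw [← AlternatingMap.coe_multilinearMap, MultilinearMap.map_sum]
      refine Finset.sum_congr rfl fun f _ => ?_
      rw [MultilinearMap.map_smul_univ]
      rfl
    rw [h1]
    refine Fintype.sum_equiv (σ.arrowCongr (Equiv.refl ι)) _ _ fun f => ?_
    have h2 : (N.submatrix f id).det =
        ((Equiv.Perm.sign σ : ℤ) : R) * (N.submatrix (f ∘ σ.symm) id).det := by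
      have := Matrix.det_permute σ (N.submatrix (f ∘ σ.symm) id)
      rw [← this]
      congr 1
      ext i j
      simp
    have h3 : ∏ i, M (σ i) (f i) = ∏ i, M i ((f ∘ σ.symm) i) := by
      exact Fintype.prod_equiv σ _ _ fun i => by simp
    rw [h2, h3]
    have h4 : ((Equiv.Perm.sign σ : ℤ) : R) * ((Equiv.Perm.sign σ : ℤ) : R) = 1 := by
      rcases Int.units_eq_one_or (Equiv.Perm.sign σ) with h | h <;> simp [h]
    change _ = (∏ i, M i ((f ∘ σ.symm) i)) * (N.submatrix (f ∘ σ.symm) id).det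
    linear_combination ((∏ i, M i ((f ∘ σ.symm) i)) * (N.submatrix (f ∘ σ.symm) id).det) * h4
  have : ((Fintype.card m).factorial : R) * (M * N).det = ∑ σ : Equiv.Perm m, (M * N).det := by
    rw [Finset.sum_const, Finset.card_univ, Fintype.card_perm, nsmul_eq_mul]
  rw [this, ← Finset.sum_congr rfl fun σ _ => key σ, Finset.sum_comm]
  refine Finset.sum_congr rfl fun f _ => ?_
  rw [← Finset.sum_mul, Matrix.det_apply' (M.submatrix id f)]
  rfl

open Matrix in
/-- A rank one perturbation changes the determinant by a multiple of its coefficient. -/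
theorem Matrix.exists_det_add_smul_vecMulVec {m R : Type*} [Fintype m] [DecidableEq m]
    [CommRing R] (A : Matrix m m R) (u v : m → R) :
    ∃ d : R, ∀ c : R, (A + c • vecMulVec u v).det = A.det + c * d := by
  -- The determinant of A bordered by the column u and a last row r is linear in r. The row (-cv, 1)
  -- has the Schur complement A + c uvᵀ.
  let B : (m ⊕ Unit → R) → Matrix (m ⊕ Unit) (m ⊕ Unit) R := fun r =>
    (fromBlocks A (replicateCol Unit u) 0 1).updateRow (Sum.inr ()) r
  have hB : ∀ c : R, (A + c • vecMulVec u v).det =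
      (B (Sum.elim (0 : m → R) (1 : Unit → R) + c • Sum.elim (-v) (0 : Unit → R))).det := by
    intro c
    have : B (Sum.elim (0 : m → R) (1 : Unit → R) + c • Sum.elim (-v) (0 : Unit → R)) =
        fromBlocks A (replicateCol Unit u) (replicateRow Unit (c • (-v))) 1 := by
      ext i j
      rcases i with i | i <;> rcases j with j | j <;> simp [B]
    rw [this, det_fromBlocks_one₂₂]
    congr 1
    ext i j
    simp [vecMulVec, Matrix.mul_apply]
    ring
  refine ⟨(B (Sum.elim (-v) (0 : Unit → R))).det, fun c => ?_⟩
  rw [hB c]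
  have h0 := hB 0
  simp only [zero_smul, add_zero] at h0
  rw [h0]
  simp only [B, det_updateRow_add, det_updateRow_smul]

/-! ### Bordered minors -/

/-- The leading principal minor of order `k`. -/
def leadingMinor {R : Type*} [CommRing R] (A : ℕ → ℕ → R) (k : ℕ) : R :=
  (Matrix.of fun a b : Fin k => A a b).det

/-- The leading minor of order `k`, bordered by row `i` and column `l`. -/
def borderedMinor {R : Type*} [CommRing R] (A : ℕ → ℕ → R) (k i l : ℕ) : R :=
  (Matrix.of fun a b : Fin k ⊕ Fin 1 =>
    A (Sum.elim (fun c : Fin k => (c : ℕ)) (fun _ => i) a)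
      (Sum.elim (fun c : Fin k => (c : ℕ)) (fun _ => l) b)).det

theorem leadingMinor_zero {R : Type*} [CommRing R] (A : ℕ → ℕ → R) : leadingMinor A 0 = 1 := by
  simp [leadingMinor]

theorem borderedMinor_zero {R : Type*} [CommRing R] (A : ℕ → ℕ → R) (i l : ℕ) :
    borderedMinor A 0 i l = A i l := by
  rw [borderedMinor, ← Matrix.det_submatrix_equiv_self (Equiv.emptySum (Fin 0) (Fin 1)).symm]
  simp

theorem borderedMinor_self {R : Type*} [CommRing R] (A : ℕ → ℕ → R) (k : ℕ) :
    borderedMinor A k k k = leadingMinor A (k + 1) := by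
  rw [borderedMinor, leadingMinor, ← Matrix.det_submatrix_equiv_self finSumFinEquiv]
  congr 1
  ext a b
  rcases a with a | a <;> rcases b with b | b <;> simp

-- Sylvester's identity. Each bordered minor is det A₀ times an entry of the Schur complement S of
-- A₀, and bordering twice gives det A₀ times a 2 × 2 determinant of entries of S.
open Matrix in
theorem borderedMinor_succ_mul_of_field {K : Type*} [Field K] (A : ℕ → ℕ → K) (k i l : ℕ)
    (hk : leadingMinor A k ≠ 0) :
    borderedMinor A (k + 1) i l * leadingMinor A k =
      borderedMinor A k k k * borderedMinor A k i l -
        borderedMinor A k i k * borderedMinor A k k l := by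
  set A₀ : Matrix (Fin k) (Fin k) K := of fun a b => A a b with hA₀
  have hdet : A₀.det = leadingMinor A k := rfl
  have hu : IsUnit A₀.det := by rw [hdet]; exact hk.isUnit
  let : Invertible A₀ := A₀.invertibleOfIsUnitDet hu
  let S : ℕ → ℕ → K := fun i l =>
    A i l - ∑ y : Fin k, (∑ x : Fin k, A i x * (⅟A₀) x y) * A y l
  have hS : ∀ i l, borderedMinor A k i l = A₀.det * S i l := by
    intro i l
    have : (Matrix.of fun a b : Fin k ⊕ Fin 1 =>
        A (Sum.elim (fun c : Fin k => (c : ℕ)) (fun _ => i) a)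
          (Sum.elim (fun c : Fin k => (c : ℕ)) (fun _ => l) b)) =
        fromBlocks A₀ (of fun a _ => A a l) (of fun _ b => A i b) (of fun _ _ => A i l) := by
      ext a b
      rcases a with a | a <;> rcases b with b | b <;> simp [A₀]
    rw [borderedMinor, this, det_fromBlocks₁₁, det_fin_one]
    simp [S, Matrix.mul_apply]
  let r : ℕ → Fin 2 → ℕ := fun i => ![k, i]
  have hS2 : borderedMinor A (k + 1) i l = A₀.det * (S k k * S i l - S k l * S i k) := by
    -- Regroups the last leading index k and the bordering index into one block of size 2.
    let e : Fin k ⊕ Fin 2 ≃ Fin (k + 1) ⊕ Fin 1 :=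
      ((Equiv.refl _).sumCongr (finSumFinEquiv (m := 1) (n := 1)).symm).trans
        ((Equiv.sumAssoc (Fin k) (Fin 1) (Fin 1)).symm.trans
          (finSumFinEquiv.sumCongr (Equiv.refl _)))
    have : (Matrix.of fun a b : Fin (k + 1) ⊕ Fin 1 =>
        A (Sum.elim (fun c : Fin (k + 1) => (c : ℕ)) (fun _ => i) a)
          (Sum.elim (fun c : Fin (k + 1) => (c : ℕ)) (fun _ => l) b)).submatrix e e =
        fromBlocks A₀ (of fun a b => A a (r l b)) (of fun a b => A (r i a) b)
          (of fun a b => A (r i a) (r l b)) := by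
      have he1 : ∀ a : Fin k, e (Sum.inl a) = Sum.inl (Fin.castAdd 1 a) := fun a => rfl
      have he2 : e (Sum.inr 0) = Sum.inl (Fin.last k) := rfl
      have he3 : e (Sum.inr 1) = Sum.inr 0 := rfl
      ext a b
      rcases a with a | a <;> rcases b with b | b
      · simp [A₀, he1]
      · fin_cases b <;> simp [he1, he2, he3, r]
      · fin_cases a <;> simp [he1, he2, he3, r]
      · fin_cases a <;> fin_cases b <;> simp [he2, he3, r]
    rw [borderedMinor, ← Matrix.det_submatrix_equiv_self e, this, det_fromBlocks₁₁, det_fin_two]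
    simp [S, Matrix.mul_apply, r]
  rw [hS2, hS, hS, hS, hS, ← hdet]
  ring

theorem map_leadingMinor {R S : Type*} [CommRing R] [CommRing S] (f : R →+* S)
    (A : ℕ → ℕ → R) (k : ℕ) :
    f (leadingMinor A k) = leadingMinor (fun i l => f (A i l)) k := by
  rw [leadingMinor, RingHom.map_det]
  rfl

theorem map_borderedMinor {R S : Type*} [CommRing R] [CommRing S] (f : R →+* S)
    (A : ℕ → ℕ → R) (k i l : ℕ) :
    f (borderedMinor A k i l) = borderedMinor (fun i l => f (A i l)) k i l := by
  rw [borderedMinor, RingHom.map_det]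
  rfl

/-- The step of fraction-free elimination: the division by the previous pivot is exact. -/
theorem borderedMinor_succ (A : ℕ → ℕ → ℤ) (k i l : ℕ) (hk : leadingMinor A k ≠ 0) :
    borderedMinor A (k + 1) i l =
      (borderedMinor A k k k * borderedMinor A k i l -
        borderedMinor A k i k * borderedMinor A k k l) / leadingMinor A k := by
  symm
  apply Int.ediv_eq_of_eq_mul_left hk
  symm
  have h := borderedMinor_succ_mul_of_field (fun i l => (Int.castRingHom ℚ) (A i l)) k i l
  simp only [← map_borderedMinor, ← map_leadingMinor] at h
  have h' := h (by simpa using hk)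
  rw [← map_mul, ← map_mul, ← map_mul, ← map_sub] at h'
  exact (Int.castRingHom ℚ).injective_int h'

/-- The crude Leibniz bound suffices, since its bit length is polynomial in k and the length of X.
-/
theorem abs_borderedMinor_le (A : ℕ → ℕ → ℤ) (X : ℤ) (hX : ∀ i l, |A i l| ≤ X) (k i l : ℕ) :
    |borderedMinor A k i l| ≤ (k + 1).factorial * X ^ (k + 1) := by
  have := Matrix.det_le (A := Matrix.of fun a b : Fin k ⊕ Fin 1 =>
    A (Sum.elim (fun c : Fin k => (c : ℕ)) (fun _ => i) a)
      (Sum.elim (fun c : Fin k => (c : ℕ)) (fun _ => l) b))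
    (abv := AbsoluteValue.abs) (x := X) (fun a b => hX _ _)
  simpa [borderedMinor] using this

/-! ### The incidence vectors of the edges -/

/-- The signed incidence vector of a pair, for an arbitrary orientation. -/
noncomputable def Sym2.incidenceVec {V : Type*} [DecidableEq V] (x : Sym2 V) : V → ℤ :=
  Pi.single (Quot.out x).1 1 - Pi.single (Quot.out x).2 1

theorem Sym2.exists_incidenceVec_eq {V : Type*} [DecidableEq V] (x : Sym2 V) :
    ∃ a c, x = s(a, c) ∧ x.incidenceVec = Pi.single a 1 - Pi.single c 1 :=
  ⟨(Quot.out x).1, (Quot.out x).2, (Quot.out_eq x).symm, rfl⟩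

theorem Sym2.incidenceVec_mk {V : Type*} [DecidableEq V] (a c : V) :
    s(a, c).incidenceVec = Pi.single a 1 - Pi.single c 1 ∨
      s(a, c).incidenceVec = Pi.single c 1 - Pi.single a 1 := by
  obtain ⟨a', c', h, h'⟩ := s(a, c).exists_incidenceVec_eq
  rw [h']
  rcases Sym2.eq_iff.1 h with ⟨rfl, rfl⟩ | ⟨rfl, rfl⟩ <;> simp

/-- The orientation enters twice, so its sign cancels and the arbitrary choice is harmless. -/
theorem Sym2.incidenceVec_mk_mul {V : Type*} [DecidableEq V] (a c u w : V) :
    s(a, c).incidenceVec u * s(a, c).incidenceVec w =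
      ((if u = a then 1 else 0) - (if u = c then 1 else 0)) *
        ((if w = a then 1 else 0) - (if w = c then 1 else 0)) := by
  rcases Sym2.incidenceVec_mk a c with h | h <;> rw [h] <;>
    simp only [Pi.sub_apply, Pi.single_apply]
  ring

theorem Sym2.sum_mul_incidenceVec_mk {V : Type*} [Fintype V] [DecidableEq V] (y : V → ℤ)
    (a c : V) :
    ∑ v, y v * s(a, c).incidenceVec v = y a - y c ∨
      ∑ v, y v * s(a, c).incidenceVec v = y c - y a := by
  rcases Sym2.incidenceVec_mk a c with h | h <;> rw [h] <;>
    simp [mul_sub, Finset.sum_sub_distrib, Pi.single_apply]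

namespace Multigraph

variable {V : Type*}

theorem mult_diag (G : Multigraph V) (u : V) : G.mult s(u, u) = 0 := by
  by_contra h
  have := (G.mult_pos_iff s(u, u)).1 (Nat.pos_of_ne_zero h)
  simp at this

theorem Edge.mem_edgeSet {G : Multigraph V} (e : G.Edge) : e.1 ∈ G.graph.edgeSet :=
  (G.mult_pos_iff e.1).1 (lt_of_le_of_lt (Nat.zero_le _) e.2.2)

/-- Each pair contributes a rank one matrix. The sum may run over all of `Sym2 V`, because pairs
that are not edges have multiplicity 0. -/
theorem laplacian_apply_eq_sum [Fintype V] [DecidableEq V] (G : Multigraph V) (u w : V) :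
    G.laplacian u w =
      ∑ x : Sym2 V, (G.mult x : ℤ) * (x.incidenceVec u * x.incidenceVec w) := by
  by_cases h : u = w
  · subst h
    have hx : ∀ x : Sym2 V, (G.mult x : ℤ) * (x.incidenceVec u * x.incidenceVec u) =
        if x ∈ Finset.univ.image (fun v => s(u, v)) then (G.mult x : ℤ) else 0 := by
      intro x
      induction x using Sym2.ind with
      | _ a c =>
        rw [Sym2.incidenceVec_mk_mul]
        by_cases hac : a = c
        · subst hac; simp [mult_diag]
        · simp only [Finset.mem_image, Finset.mem_univ, true_and, Sym2.eq_iff]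
          by_cases ha : u = a
          · subst ha; simp [hac]
          · by_cases hc : u = c
            · subst hc; simp [ha]
            · simp [ha, hc]
    rw [Finset.sum_congr rfl fun x _ => hx x, Finset.sum_ite_mem, Finset.univ_inter,
      Finset.sum_image (fun a _ c _ h => Sym2.congr_right.1 h)]
    simp [laplacian, mult_diag]
  · have hx : ∀ x : Sym2 V, (G.mult x : ℤ) * (x.incidenceVec u * x.incidenceVec w) =
        if x = s(u, w) then -(G.mult x : ℤ) else 0 := by
      intro x
      induction x using Sym2.ind with
      | _ a c =>
        rw [Sym2.incidenceVec_mk_mul]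
        by_cases hac : a = c
        · subst hac; simp [mult_diag]
        · by_cases hu : u = a
          · subst hu
            by_cases hw : w = c
            · subst hw; simp [h, Ne.symm h]
            · simp [Ne.symm h, hw, Ne.symm hw, h]
          · by_cases hw : w = a
            · subst hw
              by_cases hu : u = c
              · subst hu; simp [h, Ne.symm h]
              · simp [h, hu, Ne.symm hu, Ne.symm h]
            · have hne : s(a, c) ≠ s(u, w) := by
                rw [Ne, Sym2.eq_iff]
                rintro (⟨h1, -⟩ | ⟨h1, -⟩)
                exacts [hu h1.symm, hw h1.symm]
              rw [if_neg hne]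
              by_cases hu' : u = c
              · have hw' : w ≠ c := fun h' => h (hu'.trans h'.symm)
                simp [hw, hw']
              · simp [hu, hu']
    rw [Finset.sum_congr rfl fun x _ => hx x, Finset.sum_ite_eq' Finset.univ]
    simp [laplacian, h]

theorem laplacian_mulVec_one [Fintype V] [DecidableEq V] (G : Multigraph V) :
    G.laplacian.mulVec 1 = 0 := by
  ext u
  simp [laplacian, Matrix.mulVec, dotProduct, Finset.sum_sub_distrib, Matrix.diagonal_apply]

/-- The quadratic form of the Laplacian. -/
theorem dotProduct_laplacian_mulVec [Fintype V] [DecidableEq V] (G : Multigraph V) (y : V → ℤ) :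
    y ⬝ᵥ G.laplacian.mulVec y =
      ∑ x : Sym2 V, (G.mult x : ℤ) * (∑ v, y v * x.incidenceVec v) ^ 2 := by
  simp only [dotProduct, Matrix.mulVec, laplacian_apply_eq_sum, Finset.mul_sum, Finset.sum_mul,
    sq]
  rw [Finset.sum_congr rfl fun u _ => Finset.sum_comm, Finset.sum_comm]
  refine Finset.sum_congr rfl fun x _ => ?_
  rw [Finset.sum_comm]
  exact Finset.sum_congr rfl fun u _ => Finset.sum_congr rfl fun w _ => by ring

theorem dotProduct_laplacian_mulVec_nonneg [Fintype V] [DecidableEq V] (G : Multigraph V)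
    (y : V → ℤ) : 0 ≤ y ⬝ᵥ G.laplacian.mulVec y := by
  rw [dotProduct_laplacian_mulVec]
  exact Finset.sum_nonneg fun x _ => by positivity

/-- For a connected multigraph, the form of the Laplacian vanishes only at the constants. -/
theorem eq_of_dotProduct_laplacian_mulVec_eq_zero [Fintype V] [DecidableEq V]
    {G : Multigraph V} (hG : G.Connected) {y : V → ℤ}
    (hy : y ⬝ᵥ G.laplacian.mulVec y = 0) (u w : V) : y u = y w := by
  rw [dotProduct_laplacian_mulVec, Finset.sum_eq_zero_iff_of_nonneg
    (fun x _ => by positivity)] at hy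
  obtain ⟨p⟩ := hG.preconnected u w
  induction p with
  | nil => rfl
  | @cons a c w hac p ih =>
    rw [← ih]
    have h1 := hy s(a, c) (Finset.mem_univ _)
    have h2 : 0 < G.mult s(a, c) := (G.mult_pos_iff _).2 hac
    have h3 : ∑ v, y v * s(a, c).incidenceVec v = 0 := by
      rcases mul_eq_zero.1 h1 with h | h
      · exact absurd h (by exact_mod_cast h2.ne')
      · exact pow_eq_zero_iff two_ne_zero |>.1 h
    rcases Sym2.sum_mul_incidenceVec_mk y a c with h | h <;> rw [h3] at h <;> omega

/-! ### The matrix-tree theorem -/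

/-- The signed incidence matrix, with an additional column that marks the root `r`. -/
noncomputable def rootedIncidence [DecidableEq V] (G : Multigraph V) (r : V) :
    Matrix V (Option G.Edge) ℤ :=
  Matrix.of fun v o => o.elim ((Pi.single r 1 : V → ℤ) v) fun e => e.1.incidenceVec v

/-- The root column adds 1 to the diagonal entry at r. Written as a change of row r, it can be split
off by linearity of the determinant. -/
theorem rootedIncidence_mul_transpose [Fintype V] [DecidableEq V] (G : Multigraph V) (r : V) :
    G.rootedIncidence r * (G.rootedIncidence r).transpose =
      G.laplacian.updateRow r (G.laplacian r + Pi.single r 1) := by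
  ext u w
  have h : (G.rootedIncidence r * (G.rootedIncidence r).transpose) u w =
      (Pi.single r 1 : V → ℤ) u * (Pi.single r 1 : V → ℤ) w + G.laplacian u w := by
    rw [Matrix.mul_apply, Fintype.sum_option, laplacian_apply_eq_sum, Fintype.sum_sigma]
    simp [rootedIncidence]
  rw [h, Matrix.updateRow_apply]
  by_cases hu : u = r
  · subst hu; simp [add_comm]
  · simp [hu]

/-- Linearity in row r leaves det L, which is 0 since L kills the constants, and the determinant
with row r replaced by a unit vector. -/
theorem det_rootedIncidence_mul_transpose [Fintype V] [DecidableEq V] (G : Multigraph V)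
    (r : V) :
    (G.rootedIncidence r * (G.rootedIncidence r).transpose).det = G.laplacian.adjugate r r := by
  have h : G.laplacian.det = 0 :=
    Matrix.exists_mulVec_eq_zero_iff.1
      ⟨1, fun h => one_ne_zero (congrFun h r), G.laplacian_mulVec_one⟩
  rw [rootedIncidence_mul_transpose, Matrix.det_updateRow_add, Matrix.adjugate_apply,
    Matrix.updateRow_eq_self, h, zero_add]

/-- The selection `f` of columns contains the root column, and its edges connect all vertices. -/
def IsRootedConnected {G : Multigraph V} (f : V → Option G.Edge) : Prop :=
  (∃ v, f v = none) ∧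
    (SimpleGraph.fromEdgeSet {x : Sym2 V | ∃ v e, f v = some e ∧ e.1 = x}).Connected

/-- The selected columns span the integer lattice: the root column is the unit vector at r, and
along a walk each selected edge carries the unit vector of one end to that of the other. An integer
right inverse makes the determinant a unit of ℤ. -/
theorem det_rootedIncidence_submatrix_sq [Fintype V] [DecidableEq V] (G : Multigraph V) (r : V)
    {f : V → Option G.Edge} (hf : IsRootedConnected f) :
    ((G.rootedIncidence r).submatrix id f).det ^ 2 = 1 := by
  obtain ⟨⟨v₀, hv₀⟩, hc⟩ := hf
  set B := (G.rootedIncidence r).submatrix id f with hB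
  have hcol : ∀ v, B.mulVec (Pi.single v 1) = fun u => G.rootedIncidence r u (f v) := by
    intro v
    ext u
    simp [B]
  have key : ∀ v, ∃ y, B.mulVec y = Pi.single v 1 := by
    intro v
    obtain ⟨p⟩ := hc.preconnected r v
    suffices ∀ a, ∀ p : (SimpleGraph.fromEdgeSet
        {x : Sym2 V | ∃ v e, f v = some e ∧ e.1 = x}).Walk a v,
        (∃ y, B.mulVec y = Pi.single a 1) → ∃ y, B.mulVec y = Pi.single v 1 from
      this r p ⟨Pi.single v₀ 1, by rw [hcol, hv₀]; rfl⟩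
    clear p
    intro a p
    induction p with
    | nil => exact id
    | @cons a c v hac p ih =>
      rintro ⟨y, hy⟩
      apply ih
      · obtain ⟨⟨v₁, e, hv₁, he⟩, -⟩ := (SimpleGraph.fromEdgeSet_adj _).1 hac
        have h1 : B.mulVec (Pi.single v₁ 1) = s(a, c).incidenceVec := by
          rw [hcol, hv₁, ← he]; rfl
        rcases Sym2.incidenceVec_mk a c with h | h
        · exact ⟨y - Pi.single v₁ 1, by rw [Matrix.mulVec_sub, hy, h1, h]; abel⟩
        · exact ⟨y + Pi.single v₁ 1, by rw [Matrix.mulVec_add, hy, h1, h]; abel⟩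
  choose y hy using key
  have hinv : B * Matrix.of (fun u v => y v u) = 1 := by
    ext u v
    have := congrFun (hy v) u
    rw [Matrix.one_apply]
    rw [Pi.single_apply] at this
    exact this
  have hu := Matrix.isUnit_det_of_right_inverse hinv
  rcases Int.isUnit_iff.1 hu with h | h <;> simp [h]

/-- There is a nonzero vector in the left kernel: the constant 1 if the root column is missing, and
otherwise the indicator of the vertices not reachable from r, since no selected edge leaves the
component of r. -/
theorem det_rootedIncidence_submatrix_eq_zero [Fintype V] [DecidableEq V] (G : Multigraph V)
    (r : V) {f : V → Option G.Edge} (hf : ¬ IsRootedConnected f) :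
    ((G.rootedIncidence r).submatrix id f).det = 0 := by
  suffices ∃ y : V → ℤ, y ≠ 0 ∧ (∀ v, f v = none → y r = 0) ∧
      ∀ v e, f v = some e → ∑ u, y u * e.1.incidenceVec u = 0 by
    obtain ⟨y, hy, h0, h1⟩ := this
    refine Matrix.exists_vecMul_eq_zero_iff.1 ⟨y, hy, ?_⟩
    ext v
    rcases h : f v with _ | e
    · simp [Matrix.vecMul, dotProduct, rootedIncidence, h, h0 v h, Pi.single_apply]
    · simpa [Matrix.vecMul, dotProduct, rootedIncidence, h] using h1 v e h
  by_cases hn : ∃ v, f v = none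
  · have hc : ∃ a, ¬ (SimpleGraph.fromEdgeSet
        {x : Sym2 V | ∃ v e, f v = some e ∧ e.1 = x}).Reachable r a := by
      by_contra! h
      exact hf ⟨hn, (SimpleGraph.connected_iff _).2 ⟨fun a c => (h a).symm.trans (h c), ⟨r⟩⟩⟩
    obtain ⟨a, ha⟩ := hc
    classical
    refine ⟨fun v => if (SimpleGraph.fromEdgeSet
        {x : Sym2 V | ∃ v e, f v = some e ∧ e.1 = x}).Reachable r v then 0 else 1,
      fun h => ?_, fun v _ => by simp, fun v e he => ?_⟩
    · have h' := congrFun h a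
      simp only [if_neg ha] at h'
      exact one_ne_zero h'
    · obtain ⟨b, c, hbc, -⟩ := e.1.exists_incidenceVec_eq
      have hne : b ≠ c := by
        have := e.mem_edgeSet
        rw [hbc] at this
        exact G.graph.ne_of_adj this
      have hadj : (SimpleGraph.fromEdgeSet
          {x : Sym2 V | ∃ v e, f v = some e ∧ e.1 = x}).Adj b c :=
        (SimpleGraph.fromEdgeSet_adj _).2 ⟨⟨v, e, he, hbc⟩, hne⟩
      have hiff : (SimpleGraph.fromEdgeSet
          {x : Sym2 V | ∃ v e, f v = some e ∧ e.1 = x}).Reachable r b ↔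
          (SimpleGraph.fromEdgeSet
            {x : Sym2 V | ∃ v e, f v = some e ∧ e.1 = x}).Reachable r c :=
        ⟨fun h => h.trans hadj.reachable, fun h => h.trans hadj.symm.reachable⟩
      rw [hbc]
      rcases Sym2.sum_mul_incidenceVec_mk (fun v => if (SimpleGraph.fromEdgeSet
        {x : Sym2 V | ∃ v e, f v = some e ∧ e.1 = x}).Reachable r v then (0 : ℤ) else 1) b c
        with h | h <;> rw [h] <;> simp only [hiff, sub_self]
  · push Not at hn
    refine ⟨1, fun h => one_ne_zero (congrFun h r), fun v hv => absurd hv (hn v),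
      fun v e _ => ?_⟩
    obtain ⟨b, c, hbc, -⟩ := e.1.exists_incidenceVec_eq
    rw [hbc]
    rcases Sym2.sum_mul_incidenceVec_mk (1 : V → ℤ) b c with h | h <;> rw [h] <;> simp

/-- `fromEdgeSet` discards only loops, and edges of G are not loops. -/
theorem edgeSet_fromEdgeSet_image {G : Multigraph V} (T : Set G.Edge) :
    (SimpleGraph.fromEdgeSet ((fun e : G.Edge => e.1) '' T)).edgeSet =
      (fun e : G.Edge => e.1) '' T := by
  rw [SimpleGraph.edgeSet_fromEdgeSet]
  refine sdiff_eq_left.2 (Set.disjoint_left.2 ?_)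
  rintro _ ⟨e, -, rfl⟩ h
  exact G.graph.not_isDiag_of_mem_edgeSet e.mem_edgeSet h

theorem IsSpanningTree.card_add_one [Fintype V] {G : Multigraph V}
    {T : Finset G.Edge} (hT : G.IsSpanningTree T) : T.card + 1 = Fintype.card V := by
  have h := (SimpleGraph.isTree_iff_connected_and_card.1 hT.2).2
  rw [edgeSet_fromEdgeSet_image, Nat.card_coe_set_eq, Set.InjOn.ncard_image hT.1,
    Set.ncard_coe_finset, Nat.card_eq_fintype_card] at h
  exact h

/-- Connectedness forces at least n - 1 underlying edges, so equality holds throughout. This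
excludes parallel edges and cycles at once. -/
theorem isSpanningTree_of_connected_of_card_le [Fintype V] {G : Multigraph V}
    {T : Finset G.Edge}
    (hc : (SimpleGraph.fromEdgeSet ((fun e : G.Edge => e.1) '' (T : Set G.Edge))).Connected)
    (hT : T.card + 1 ≤ Fintype.card V) : G.IsSpanningTree T := by
  have h1 := hc.card_vert_le_card_edgeSet_add_one
  rw [edgeSet_fromEdgeSet_image, Nat.card_coe_set_eq, Nat.card_eq_fintype_card] at h1
  have h2 : ((fun e : G.Edge => e.1) '' (T : Set G.Edge)).ncard ≤ T.card := by
    rw [← Set.ncard_coe_finset]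
    exact Set.ncard_image_le T.finite_toSet
  refine ⟨?_, SimpleGraph.isTree_iff_connected_and_card.2 ⟨hc, ?_⟩⟩
  · apply (Set.ncard_image_iff T.finite_toSet).1
    rw [Set.ncard_coe_finset]
    omega
  · rw [edgeSet_fromEdgeSet_image, Nat.card_coe_set_eq, Nat.card_eq_fintype_card]
    omega

end Multigraph

/-! ### Counting the column selections that give a spanning tree -/

/-- By cardinality, a map onto S is a bijection onto S. -/
theorem Finset.card_filter_image_univ_eq {α β : Type*} [Fintype α] [DecidableEq α] [Fintype β]
    [DecidableEq β] (S : Finset β) (hS : S.card = Fintype.card α) :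
    (Finset.univ.filter fun f : α → β => Finset.univ.image f = S).card =
      (Fintype.card α).factorial := by
  have hc : Fintype.card α = Fintype.card S := by simp [hS]
  rw [← Fintype.card_equiv (Fintype.equivOfCardEq hc), ← Finset.card_univ]
  symm
  refine Finset.card_bij (fun (σ : α ≃ S) _ a => (σ a : β)) ?_ ?_ ?_
  · intro σ _
    simp only [Finset.mem_filter, Finset.mem_univ, true_and]
    ext b
    simp only [Finset.mem_image, Finset.mem_univ, true_and]
    exact ⟨fun ⟨a, h⟩ => h ▸ (σ a).2, fun h => ⟨σ.symm ⟨b, h⟩, by simp⟩⟩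
  · intro σ _ τ _ h
    ext a
    exact congrFun h a
  · intro f hf
    simp only [Finset.mem_filter, Finset.mem_univ, true_and] at hf
    let g : α → S := fun a => ⟨f a, hf ▸ Finset.mem_image_of_mem f (Finset.mem_univ a)⟩
    have hg : Function.Surjective g := by
      rintro ⟨b, hb⟩
      rw [← hf] at hb
      obtain ⟨a, -, ha⟩ := Finset.mem_image.1 hb
      exact ⟨a, Subtype.ext ha⟩
    exact ⟨Equiv.ofBijective g ((Fintype.bijective_iff_surjective_and_card g).2 ⟨hg, hc⟩),
      Finset.mem_univ _, rfl⟩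

namespace Multigraph

variable {V : Type*}

/-- One of the at most |V| selected columns is the root, so at most |V| - 1 edges are selected;
being connected, they form a spanning tree. -/
theorem isRootedConnected_iff [Fintype V] [DecidableEq V] {G : Multigraph V}
    {f : V → Option G.Edge} {T : Finset G.Edge} :
    IsRootedConnected f ∧ (Finset.univ.image f).eraseNone = T ↔
      G.IsSpanningTree T ∧ Finset.univ.image f = T.insertNone := by
  have hset : {x : Sym2 V | ∃ v e, f v = some e ∧ e.1 = x} =
      (fun e : G.Edge => e.1) '' ((Finset.univ.image f).eraseNone : Set G.Edge) := by
    ext x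
    simp only [Set.mem_ofPred_eq, Set.mem_image, Finset.mem_coe, Finset.mem_eraseNone,
      Finset.mem_image, Finset.mem_univ, true_and]
    exact ⟨fun ⟨v, e, h, h'⟩ => ⟨e, ⟨v, h⟩, h'⟩, fun ⟨e, ⟨v, h⟩, h'⟩ => ⟨v, e, h, h'⟩⟩
  rw [IsRootedConnected, hset]
  constructor
  · rintro ⟨⟨⟨v, hv⟩, hc⟩, rfl⟩
    have hi : ((Finset.univ.image f).eraseNone).insertNone = Finset.univ.image f := by
      rw [Finset.insertNone_eraseNone, Finset.insert_eq_self]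
      exact Finset.mem_image.2 ⟨v, Finset.mem_univ _, hv⟩
    refine ⟨isSpanningTree_of_connected_of_card_le hc ?_, hi.symm⟩
    rw [← Finset.card_insertNone, hi]
    exact Finset.card_image_le
  · rintro ⟨hT, h⟩
    rw [h, Finset.eraseNone_insertNone]
    refine ⟨⟨?_, hT.2.connected⟩, rfl⟩
    have : none ∈ Finset.univ.image f := by rw [h]; simp
    simpa using this

/-- The matrix-tree theorem for the principal cofactors. -/
theorem adjugate_laplacian_self [Fintype V] [DecidableEq V] (G : Multigraph V) (r : V) :
    G.laplacian.adjugate r r = G.treeCount := by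
  classical
  have h := Matrix.factorial_mul_det_mul (G.rootedIncidence r) (G.rootedIncidence r).transpose
  rw [det_rootedIncidence_mul_transpose] at h
  have hsq : ∀ f : V → Option G.Edge,
      ((G.rootedIncidence r).submatrix id f).det *
        ((G.rootedIncidence r).transpose.submatrix f id).det =
        if IsRootedConnected f then 1 else 0 := by
    intro f
    rw [← Matrix.transpose_submatrix, Matrix.det_transpose, ← sq]
    split_ifs with hf
    · exact det_rootedIncidence_submatrix_sq G r hf
    · rw [det_rootedIncidence_submatrix_eq_zero G r hf]; simp
  have hcount : (Finset.univ.filter fun f : V → Option G.Edge => IsRootedConnected f).card =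
      (Fintype.card V).factorial * G.treeCount := by
    -- The fibre over a tree T consists of the |V|! bijections from V onto T together with the root
    -- column.
    rw [Finset.card_eq_sum_card_fiberwise (f := fun f => (Finset.univ.image f).eraseNone)
      (t := Finset.univ.filter fun T : Finset G.Edge => G.IsSpanningTree T)]
    · rw [treeCount, mul_comm, ← smul_eq_mul, ← Finset.sum_const]
      refine Finset.sum_congr rfl fun T hT => ?_
      have hT' := (Finset.mem_filter.1 hT).2
      rw [← Finset.card_filter_image_univ_eq T.insertNone
        (by rw [Finset.card_insertNone, hT'.card_add_one])]
      congr 1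
      ext f
      simp only [Finset.mem_filter, Finset.mem_univ, true_and, isRootedConnected_iff, hT']
    · intro f hf
      simp only [Finset.coe_filter, Finset.mem_univ, true_and, Set.mem_ofPred_eq] at hf ⊢
      exact (isRootedConnected_iff.1 ⟨hf, rfl⟩).1
  rw [Finset.sum_congr rfl fun f _ => hsq f, Finset.sum_boole, hcount] at h
  push_cast at h
  exact mul_left_cancel₀ (by exact_mod_cast (Nat.factorial_pos _).ne') h

/-- The matrix-tree theorem. -/
theorem adjugate_laplacian [Fintype V] [DecidableEq V] {G : Multigraph V} (hG : G.Connected)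
    (u w : V) : G.laplacian.adjugate u w = G.treeCount := by
  have hdet : G.laplacian.det = 0 :=
    Matrix.exists_mulVec_eq_zero_iff.1
      ⟨1, fun h => one_ne_zero (congrFun h u), G.laplacian_mulVec_one⟩
  have hmul := Matrix.mul_adjugate G.laplacian
  rw [hdet, zero_smul] at hmul
  -- L · adj L = 0 puts each column of the adjugate into the kernel of L, so the column is constant
  -- and equal to its diagonal entry.
  have hw : G.laplacian.mulVec (fun v => G.laplacian.adjugate v w) = 0 := by
    ext v
    exact congrFun (congrFun hmul v) w
  rw [eq_of_dotProduct_laplacian_mulVec_eq_zero hG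
    (y := fun v => G.laplacian.adjugate v w) (by rw [hw, dotProduct_zero]) u w]
  exact adjugate_laplacian_self G w

end Multigraph

namespace Multigraph

variable {V : Type*}

/-! ### The spanning connectivity game -/

theorem scg_eq_one_iff {G : Multigraph V} {S : Finset G.Edge} :
    G.scg S = 1 ↔ ∃ T : Finset G.Edge, G.IsSpanningTree T ∧ T ⊆ S := by
  unfold scg
  split_ifs with h <;> simp [h]

theorem scg_eq_zero_iff {G : Multigraph V} {S : Finset G.Edge} :
    G.scg S = 0 ↔ ¬ ∃ T : Finset G.Edge, G.IsSpanningTree T ∧ T ⊆ S := by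
  unfold scg
  split_ifs with h <;> simp [h]

/-- A minimal winning coalition cannot be larger than a tree inside it; conversely, a proper subset
of a tree has too few edges to contain another one. -/
theorem isMinimalWinning_scg_iff [Fintype V] {G : Multigraph V} {S : Finset G.Edge} :
    Game.IsMinimalWinning G.scg S ↔ G.IsSpanningTree S := by
  constructor
  · rintro ⟨h1, h2⟩
    obtain ⟨T, hT, hTS⟩ := scg_eq_one_iff.1 h1
    by_cases h : T = S
    · exact h ▸ hT
    · exact absurd ⟨T, hT, subset_rfl⟩
        (scg_eq_zero_iff.1 (h2 T (Finset.ssubset_iff_subset_ne.2 ⟨hTS, h⟩)))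
  · refine fun hS => ⟨scg_eq_one_iff.2 ⟨S, hS, subset_rfl⟩, fun T hTS => ?_⟩
    rw [scg_eq_zero_iff]
    rintro ⟨T', hT', hT'T⟩
    have h1 := Finset.card_lt_card (lt_of_le_of_lt hT'T hTS)
    have h2 := hT'.card_add_one
    have h3 := hS.card_add_one
    omega

theorem mem_minimalWinning_scg [Fintype V] [DecidableEq V] {G : Multigraph V}
    {S : Finset G.Edge} : S ∈ Game.minimalWinning G.scg ↔ G.IsSpanningTree S := by
  simp [Game.minimalWinning, isMinimalWinning_scg_iff]

theorem card_minimalWinning_scg [Fintype V] [DecidableEq V] (G : Multigraph V) :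
    (Game.minimalWinning G.scg).card = G.treeCount := by
  rw [treeCount]
  congr 1
  ext S
  rw [mem_minimalWinning_scg]
  simp

/-! ### Deletion of an edge -/

theorem Edge.ext {G : Multigraph V} {e f : G.Edge} (h1 : e.1 = f.1)
    (h2 : (e.2 : ℕ) = (f.2 : ℕ)) : e = f := by
  obtain ⟨x, k⟩ := e
  obtain ⟨y, l⟩ := f
  obtain rfl : x = y := h1
  obtain rfl : k = l := Fin.ext h2
  rfl

/-- The edges of `G ∖ e` as edges of `G`. -/
def deleteEdgeMap [DecidableEq V] (G : Multigraph V) (e : G.Edge)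
    (f : (G.deleteEdge e).Edge) : G.Edge :=
  -- Over the pair of e, the copies from position `e.2` on are shifted by one, which skips e itself.
  ⟨f.1, ⟨if f.1 = e.1 ∧ (e.2 : ℕ) ≤ f.2 then (f.2 : ℕ) + 1 else f.2, by
    obtain ⟨x, k, hk⟩ := f
    simp only [deleteEdge] at hk ⊢
    by_cases hx : x = e.1
    · subst hx
      rw [Function.update_self] at hk
      split_ifs <;> omega
    · rw [Function.update_of_ne hx] at hk
      simpa [hx] using hk⟩⟩

theorem deleteEdgeMap_fst [DecidableEq V] (G : Multigraph V) (e : G.Edge)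
    (f : (G.deleteEdge e).Edge) : (G.deleteEdgeMap e f).1 = f.1 := rfl

theorem deleteEdgeMap_snd [DecidableEq V] (G : Multigraph V) (e : G.Edge)
    (f : (G.deleteEdge e).Edge) : ((G.deleteEdgeMap e f).2 : ℕ) =
      if f.1 = e.1 ∧ (e.2 : ℕ) ≤ f.2 then (f.2 : ℕ) + 1 else f.2 := rfl

theorem deleteEdgeMap_injective [DecidableEq V] (G : Multigraph V) (e : G.Edge) :
    Function.Injective (G.deleteEdgeMap e) := by
  intro f g h
  have h1 : f.1 = g.1 := by
    rw [← G.deleteEdgeMap_fst e f, h, deleteEdgeMap_fst]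
  have h2 := congrArg (fun d : G.Edge => (d.2 : ℕ)) h
  refine Edge.ext h1 ?_
  simp only [deleteEdgeMap_snd, h1] at h2
  by_cases hx : g.1 = e.1
  · simp only [hx, true_and] at h2
    split_ifs at h2 <;> omega
  · simpa [hx] using h2

theorem range_deleteEdgeMap [DecidableEq V] (G : Multigraph V) (e : G.Edge) :
    Set.range (G.deleteEdgeMap e) = {e}ᶜ := by
  ext f
  rw [Set.mem_compl_singleton_iff]
  constructor
  · rintro ⟨g, rfl⟩ h
    have h1 : g.1 = e.1 := by rw [← G.deleteEdgeMap_fst e g, h]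
    have h2 := congrArg (fun d : G.Edge => (d.2 : ℕ)) h
    simp only [deleteEdgeMap_snd, h1, true_and] at h2
    split_ifs at h2 <;> omega
  · intro hf
    obtain ⟨x, k, hk⟩ := f
    by_cases hx : x = e.1
    · have hne : k ≠ e.2 := fun h => hf (Edge.ext hx h)
      subst hx
      have he := e.2.2
      by_cases hlt : (e.2 : ℕ) < k
      · refine ⟨⟨e.1, ⟨k - 1, ?_⟩⟩, Edge.ext rfl ?_⟩
        · simp only [deleteEdge, Function.update_self]; omega
        · have : (e.2 : ℕ) ≤ k - 1 := by omega
          rw [deleteEdgeMap_snd, if_pos ⟨rfl, this⟩]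
          change k - 1 + 1 = k
          omega
      · refine ⟨⟨e.1, ⟨k, ?_⟩⟩, Edge.ext rfl ?_⟩
        · simp only [deleteEdge, Function.update_self]; omega
        · have : ¬ (e.2 : ℕ) ≤ k := by omega
          rw [deleteEdgeMap_snd, if_neg fun h => this h.2]
    · refine ⟨⟨x, ⟨k, ?_⟩⟩, Edge.ext rfl ?_⟩
      · simpa only [deleteEdge, Function.update_of_ne hx] using hk
      · rw [deleteEdgeMap_snd, if_neg fun h => hx h.1]

/-- `deleteEdgeMap` as an embedding. -/
def deleteEdgeEmb [DecidableEq V] (G : Multigraph V) (e : G.Edge) :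
    (G.deleteEdge e).Edge ↪ G.Edge :=
  ⟨G.deleteEdgeMap e, G.deleteEdgeMap_injective e⟩

theorem isSpanningTree_map_iff {G H : Multigraph V} (φ : H.Edge ↪ G.Edge)
    (hφ : ∀ f, (φ f).1 = f.1) (T : Finset H.Edge) :
    G.IsSpanningTree (T.map φ) ↔ H.IsSpanningTree T := by
  have hcomp : (fun e : G.Edge => e.1) ∘ φ = fun f : H.Edge => f.1 := funext hφ
  have himg : (fun e : G.Edge => e.1) '' ((T.map φ : Finset G.Edge) : Set G.Edge) =
      (fun f : H.Edge => f.1) '' (T : Set H.Edge) := by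
    rw [Finset.coe_map, ← Set.image_comp, hcomp]
  rw [IsSpanningTree, IsSpanningTree, himg, Finset.coe_map]
  refine and_congr_left fun _ => ⟨fun h a ha b hb hab => ?_, ?_⟩
  · exact φ.injective (h ⟨a, ha, rfl⟩ ⟨b, hb, rfl⟩ (by simpa only [hφ] using hab))
  · rintro h _ ⟨a, ha, rfl⟩ _ ⟨b, hb, rfl⟩ hab
    exact congrArg φ (h ha hb (by simpa only [hφ] using hab))

-- Trees are transported along `deleteEdgeEmb`, which preserves the underlying pairs and misses only
-- e.
open Classical in
theorem treeCount_deleteEdge [Fintype V] [DecidableEq V] (G : Multigraph V) (e : G.Edge) :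
    (G.deleteEdge e).treeCount =
      (Finset.univ.filter fun T : Finset G.Edge => G.IsSpanningTree T ∧ e ∉ T).card := by
  rw [treeCount]
  refine Finset.card_bij (fun T _ => T.map (G.deleteEdgeEmb e)) ?_ ?_ ?_
  · intro T hT
    refine Finset.mem_filter.2 ⟨Finset.mem_univ _,
      (isSpanningTree_map_iff _ (G.deleteEdgeMap_fst e) T).2 (Finset.mem_filter.1 hT).2, ?_⟩
    intro h
    obtain ⟨f, -, hf⟩ := Finset.mem_map.1 h
    have : e ∈ Set.range (G.deleteEdgeMap e) := ⟨f, hf⟩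
    rw [range_deleteEdgeMap] at this
    exact this rfl
  · exact fun T _ T' _ h => Finset.map_injective _ h
  · intro T hT
    obtain ⟨-, hT, he⟩ := Finset.mem_filter.1 hT
    have hmap : (T.preimage (G.deleteEdgeEmb e) (G.deleteEdgeEmb e).injective.injOn).map
        (G.deleteEdgeEmb e) = T := by
      ext f
      simp only [Finset.mem_map, Finset.mem_preimage]
      refine ⟨fun ⟨g, hg, h⟩ => h ▸ hg, fun hf => ?_⟩
      have : f ∈ Set.range (G.deleteEdgeMap e) := by
        rw [range_deleteEdgeMap]
        exact fun h => he (h ▸ hf)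
      obtain ⟨g, rfl⟩ := this
      exact ⟨g, hf, rfl⟩
    refine ⟨_, Finset.mem_filter.2 ⟨Finset.mem_univ _, ?_⟩, hmap⟩
    rw [← isSpanningTree_map_iff (G.deleteEdgeEmb e) (G.deleteEdgeMap_fst e), hmap]
    exact hT

theorem hollerValue_add_treeCount_deleteEdge [Fintype V] [DecidableEq V] (G : Multigraph V)
    (e : G.Edge) :
    Game.hollerValue G.scg e + (G.deleteEdge e).treeCount = G.treeCount := by
  classical
  rw [treeCount_deleteEdge, ← card_minimalWinning_scg, Game.hollerValue,
    Game.minimalWinningWith,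
    ← Finset.card_filter_add_card_filter_not (s := Game.minimalWinning G.scg) (fun S => e ∈ S)]
  congr 2 <;> ext S <;> simp [mem_minimalWinning_scg]

theorem connected_of_isSpanningTree {G : Multigraph V} {T : Finset G.Edge}
    (hT : G.IsSpanningTree T) : G.Connected := by
  refine hT.2.connected.mono fun a c h => ?_
  obtain ⟨⟨e, -, he⟩, -⟩ := (SimpleGraph.fromEdgeSet_adj _).1 h
  rw [← SimpleGraph.mem_edgeSet]
  exact he ▸ e.mem_edgeSet

theorem treeCount_eq_zero_of_not_connected [Fintype V] [DecidableEq V] {G : Multigraph V}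
    (h : ¬ G.Connected) : G.treeCount = 0 := by
  classical
  rw [treeCount, Finset.card_eq_zero, Finset.filter_eq_empty_iff]
  exact fun T _ hT => h (connected_of_isSpanningTree hT)

/-- Double counting of the pairs of a tree and one of its edges. -/
theorem sum_hollerValue_scg [Fintype V] [DecidableEq V] (G : Multigraph V) :
    ∑ e, Game.hollerValue G.scg e = G.treeCount * (Fintype.card V - 1) := by
  classical
  have h : ∀ e, Game.hollerValue G.scg e =
      ∑ S ∈ Game.minimalWinning G.scg, if e ∈ S then 1 else 0 := fun e => by
    rw [Game.hollerValue, Game.minimalWinningWith, Finset.card_filter]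
    exact Finset.sum_congr rfl fun S _ => by congr
  rw [Finset.sum_congr rfl fun e _ => h e, Finset.sum_comm, ← card_minimalWinning_scg,
    ← smul_eq_mul, ← Finset.sum_const]
  refine Finset.sum_congr rfl fun S hS => ?_
  have := (mem_minimalWinning_scg.1 hS).card_add_one
  simp
  omega

theorem hollerIndex_scg [Fintype V] [DecidableEq V] (G : Multigraph V) (e : G.Edge) :
    Game.hollerIndex G.scg e =
      (Game.hollerValue G.scg e : ℚ) / (G.treeCount * (Fintype.card V - 1 : ℕ)) := by
  rw [Game.hollerIndex, ← Nat.cast_sum, sum_hollerValue_scg, Nat.cast_mul]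

theorem deeganPackelIndex_scg [Fintype V] [DecidableEq V] (G : Multigraph V) (e : G.Edge) :
    Game.deeganPackelIndex G.scg e =
      (Game.hollerValue G.scg e : ℚ) / (G.treeCount * (Fintype.card V - 1 : ℕ)) := by
  have h : ∀ S ∈ Game.minimalWinningWith G.scg e,
      1 / (S.card : ℚ) = 1 / (Fintype.card V - 1 : ℕ) := by
    intro S hS
    simp only [Game.minimalWinningWith, Finset.mem_filter] at hS
    have := (mem_minimalWinning_scg.1 hS.1).card_add_one
    rw [← this, Nat.add_sub_cancel]
  rw [Game.deeganPackelIndex, Finset.sum_congr rfl h, Finset.sum_const, nsmul_eq_mul,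
    card_minimalWinning_scg, Game.hollerValue]
  -- Since 0⁻¹ = 0 respects products, no denominator has to be shown nonzero.
  simp only [div_eq_mul_inv, mul_inv]
  ring

theorem laplacian_deleteEdge_apply [Fintype V] [DecidableEq V] (G : Multigraph V) (e : G.Edge)
    (u w : V) :
    (G.deleteEdge e).laplacian u w =
      G.laplacian u w - e.1.incidenceVec u * e.1.incidenceVec w := by
  have he : 0 < G.mult e.1 := (G.mult_pos_iff _).2 e.mem_edgeSet
  have h : ∀ x : Sym2 V, (((G.deleteEdge e).mult x : ℕ) : ℤ) =
      (G.mult x : ℤ) - if x = e.1 then 1 else 0 := by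
    intro x
    by_cases hx : x = e.1
    · subst hx
      simp only [deleteEdge, Function.update_self, if_true]
      omega
    · simp [deleteEdge, hx]
  simp only [laplacian_apply_eq_sum, h, sub_mul, Finset.sum_sub_distrib, ite_mul, one_mul,
    zero_mul, Finset.sum_ite_eq', Finset.mem_univ, if_true]

end Multigraph

/-! ### Principal cofactors as leading minors -/

/-- With the last vertex as root, the cofactor is the leading minor that elimination produces; its
sign is an even power of -1. -/
theorem Matrix.adjugate_last_eq_leadingMinor {n : ℕ} (r : Fin n) (hr : (r : ℕ) + 1 = n)
    (A : Matrix (Fin n) (Fin n) ℤ) (A' : ℕ → ℕ → ℤ) (h : ∀ i l : Fin n, A i l = A' i l) :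
    A.adjugate r r = leadingMinor A' (n - 1) := by
  obtain _ | N := n
  · exact r.elim0
  · obtain rfl : r = Fin.last N := Fin.ext (by simpa using hr)
    rw [Matrix.adjugate_fin_succ_eq_det_submatrix, leadingMinor, ← two_mul, pow_mul]
    simp only [even_two, Even.neg_pow, one_pow, one_mul]
    congr 1
    ext i l
    simp [h]

theorem exists_leadingMinor_add_mul (A : ℕ → ℕ → ℤ) (b : ℕ → ℤ) (k : ℕ) :
    ∃ d : ℤ, ∀ c : ℤ, leadingMinor (fun i l => A i l + c * (b i * b l)) k =
      leadingMinor A k + c * d := by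
  obtain ⟨d, hd⟩ := Matrix.exists_det_add_smul_vecMulVec (Matrix.of fun a c : Fin k => A a c)
    (fun a => b a) (fun a => b a)
  refine ⟨d, fun c => ?_⟩
  rw [leadingMinor, leadingMinor, ← hd c]
  rfl

/-- A kernel vector of the block, extended by zero to y, satisfies yᵀLy + (b · y)² = 0. Both terms
are nonnegative, so yᵀLy = 0 and y is constant. -/
theorem Multigraph.leadingMinor_laplacian_ne_zero {n : ℕ} {G : Multigraph (Fin n)}
    (hG : G.Connected) (A : ℕ → ℕ → ℤ) (hA : ∀ i l : Fin n, A i l = G.laplacian i l)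
    (b : ℕ → ℤ) {k : ℕ} (hk : k < n) :
    leadingMinor (fun i l => A i l + b i * b l) k ≠ 0 := by
  intro h0
  obtain ⟨v, hv, hmul⟩ := Matrix.exists_mulVec_eq_zero_iff.2 h0
  apply hv
  let y : ℕ → ℤ := fun i => if h : i < k then v ⟨i, h⟩ else 0
  have hyv : ∀ i : Fin k, y i = v i := fun i => by simp [y]
  have hy0 : ∀ i, i ∉ Finset.range k → y i = 0 := fun i hi => by
    simp [y, Finset.mem_range.not.1 hi]
  have hsub : Finset.range k ⊆ Finset.range n := Finset.range_subset_range.2 hk.le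
  have hform : ∑ i ∈ Finset.range k, ∑ l ∈ Finset.range k,
      y i * ((A i l + b i * b l) * y l) = 0 := by
    have := congrArg (fun z => v ⬝ᵥ z) hmul
    simp only [dotProduct, Matrix.mulVec, Matrix.of_apply, Pi.zero_apply, mul_zero,
      Finset.sum_const_zero, Finset.mul_sum] at this
    rw [← this, ← Fin.sum_univ_eq_sum_range
      (fun i => ∑ l ∈ Finset.range k, y i * ((A i l + b i * b l) * y l))]
    refine Finset.sum_congr rfl fun i _ => ?_
    rw [← Fin.sum_univ_eq_sum_range (fun l => y i * ((A i l + b i * b l) * y l))]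
    exact Finset.sum_congr rfl fun l _ => by rw [hyv, hyv]
  have hsplit : ∑ i ∈ Finset.range k, ∑ l ∈ Finset.range k,
      y i * ((A i l + b i * b l) * y l) =
      (fun i : Fin n => y i) ⬝ᵥ G.laplacian.mulVec (fun i : Fin n => y i) +
        (∑ i ∈ Finset.range k, y i * b i) ^ 2 := by
    have h1 : (fun i : Fin n => y i) ⬝ᵥ G.laplacian.mulVec (fun i : Fin n => y i) =
        ∑ i ∈ Finset.range k, ∑ l ∈ Finset.range k, y i * (A i l * y l) := by
      simp only [dotProduct, Matrix.mulVec, ← hA, Finset.mul_sum]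
      rw [Finset.sum_subset hsub (fun i _ hi => by simp [hy0 i hi]), ← Fin.sum_univ_eq_sum_range
        (fun i => ∑ l ∈ Finset.range k, y i * (A i l * y l))]
      refine Finset.sum_congr rfl fun i _ => ?_
      rw [Finset.sum_subset hsub (fun i _ hi => by simp [hy0 i hi]), ← Fin.sum_univ_eq_sum_range
        (fun l => y i * (A i l * y l))]
    rw [h1, sq, Finset.sum_mul_sum, ← Finset.sum_add_distrib]
    refine Finset.sum_congr rfl fun i _ => ?_
    rw [← Finset.sum_add_distrib]
    exact Finset.sum_congr rfl fun l _ => by ring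
  have hq := G.dotProduct_laplacian_mulVec_nonneg (fun i : Fin n => y i)
  have hzero : (fun i : Fin n => y i) ⬝ᵥ G.laplacian.mulVec (fun i : Fin n => y i) = 0 := by
    nlinarith [sq_nonneg (∑ i ∈ Finset.range k, y i * b i)]
  ext i
  -- Vertex k exists because k < n, and y vanishes there.
  have := eq_of_dotProduct_laplacian_mulVec_eq_zero hG hzero ⟨i, i.2.trans hk⟩ ⟨k, hk⟩
  simpa [y] using this

namespace RAM

/-! ### Bit lengths -/

theorem bitLen_le_iff {z : ℤ} {k : ℕ} : bitLen z ≤ k + 1 ↔ z.natAbs < 2 ^ k := by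
  rw [bitLen, Nat.add_le_add_iff_right, Nat.size_le]

theorem natAbs_lt_two_pow_bitLen_sub_one (z : ℤ) : z.natAbs < 2 ^ (bitLen z - 1) := by
  rw [bitLen, Nat.add_sub_cancel, ← Nat.size_le]

theorem one_le_bitLen (z : ℤ) : 1 ≤ bitLen z := Nat.le_add_left _ _

theorem bitLen_natCast_le (k : ℕ) : bitLen k ≤ k + 1 :=
  bitLen_le_iff.2 (by simpa using Nat.lt_two_pow_self)

theorem bitLen_natCast_mono {k l : ℕ} (h : k ≤ l) : bitLen k ≤ bitLen l := by
  simp only [bitLen, Int.natAbs_natCast]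
  exact Nat.add_le_add_right (Nat.size_le_size h) 1

theorem bitLen_le_of_abs_le {z : ℤ} {k : ℕ} (h : |z| ≤ 2 ^ k) : bitLen z ≤ k + 2 := by
  rw [bitLen_le_iff, pow_succ]
  have h2 : ((z.natAbs : ℕ) : ℤ) ≤ ((2 ^ k : ℕ) : ℤ) := by
    rw [Int.natCast_natAbs]
    exact_mod_cast h
  have h3 : z.natAbs ≤ 2 ^ k := by exact_mod_cast h2
  have := Nat.two_pow_pos k
  omega

/-- The sum of the lengths is generous for an addition, but it gives one rule for all four
operations; the sign bits absorb the carry. -/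
theorem bitLen_add_le (x y : ℤ) : bitLen (x + y) ≤ bitLen x + bitLen y := by
  have hx := natAbs_lt_two_pow_bitLen_sub_one x
  have hy := natAbs_lt_two_pow_bitLen_sub_one y
  have h1 := one_le_bitLen x
  have h2 := one_le_bitLen y
  obtain ⟨a, ha⟩ := Nat.exists_eq_add_of_le' h1
  obtain ⟨b, hb⟩ := Nat.exists_eq_add_of_le' h2
  rw [ha, Nat.add_sub_cancel] at hx
  rw [hb, Nat.add_sub_cancel] at hy
  rw [ha, hb, show a + 1 + (b + 1) = (a + b + 1) + 1 by ring, bitLen_le_iff]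
  have h3 := Int.natAbs_add_le x y
  have h4 : 2 ^ a ≤ 2 ^ (a + b) := Nat.pow_le_pow_right (by norm_num) (by omega)
  have h5 : 2 ^ b ≤ 2 ^ (a + b) := Nat.pow_le_pow_right (by norm_num) (by omega)
  rw [pow_succ]
  omega

theorem bitLen_sub_le (x y : ℤ) : bitLen (x - y) ≤ bitLen x + bitLen y := by
  have h := bitLen_add_le x (-y)
  rwa [← sub_eq_add_neg, show bitLen (-y) = bitLen y by simp [bitLen]] at h

theorem bitLen_mul_le (x y : ℤ) : bitLen (x * y) ≤ bitLen x + bitLen y := by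
  have hx := natAbs_lt_two_pow_bitLen_sub_one x
  have hy := natAbs_lt_two_pow_bitLen_sub_one y
  obtain ⟨a, ha⟩ := Nat.exists_eq_add_of_le' (one_le_bitLen x)
  obtain ⟨b, hb⟩ := Nat.exists_eq_add_of_le' (one_le_bitLen y)
  rw [ha, Nat.add_sub_cancel] at hx
  rw [hb, Nat.add_sub_cancel] at hy
  rw [ha, hb, show a + 1 + (b + 1) = (a + b + 1) + 1 by ring, bitLen_le_iff, Int.natAbs_mul,
    pow_succ, pow_add]
  have := Nat.mul_lt_mul'' hx hy
  omega

theorem bitLen_div_le (x y : ℤ) : bitLen (x / y) ≤ bitLen x := by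
  rw [bitLen, bitLen]
  exact Nat.add_le_add_right (Nat.size_le_size (Int.natAbs_ediv_le_natAbs x y)) 1

/-! ### Expressions -/

instance : Add Exp := ⟨.op .add⟩
instance : Sub Exp := ⟨.op .sub⟩
instance : Mul Exp := ⟨.op .mul⟩
instance : Div Exp := ⟨.op .div⟩

@[simp] theorem Exp.eval_const (σ : State) (c : ℤ) : (Exp.const c).eval σ = c := rfl
@[simp] theorem Exp.eval_get (σ : State) (a : ℕ) (i : Exp) :
    (Exp.get a i).eval σ = σ a (i.eval σ).toNat := rfl
@[simp] theorem Exp.eval_add (σ : State) (x y : Exp) :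
    (x + y).eval σ = x.eval σ + y.eval σ := rfl
@[simp] theorem Exp.eval_sub (σ : State) (x y : Exp) :
    (x - y).eval σ = x.eval σ - y.eval σ := rfl
@[simp] theorem Exp.eval_mul (σ : State) (x y : Exp) :
    (x * y).eval σ = x.eval σ * y.eval σ := rfl
@[simp] theorem Exp.eval_div (σ : State) (x y : Exp) :
    (x / y).eval σ = x.eval σ / y.eval σ := rfl

/-- If all cells have at most `B` bits, then the value of an expression has at most `mag * B`
bits. -/
def Exp.mag : Exp → ℕ
  | .const c => bitLen c
  | .get _ _ => 1
  | .op _ x y => x.mag + y.mag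

/-- If all cells have at most `B` bits, then an evaluation costs at most `weight * B`. -/
def Exp.weight : Exp → ℕ
  | .const c => bitLen c
  | .get _ i => i.weight + 1
  | .op _ x y => x.weight + y.weight + (x.mag + y.mag)

/-- All cells have at most `B` bits. -/
def State.Bounded (σ : State) (B : ℕ) : Prop := ∀ a i, bitLen (σ a i) ≤ B

theorem State.Bounded.one_le {σ : State} {B : ℕ} (h : σ.Bounded B) : 1 ≤ B :=
  (one_le_bitLen _).trans (h 0 0)

theorem Exp.bitLen_eval_le {σ : State} {B : ℕ} (h : σ.Bounded B) (e : Exp) :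
    bitLen (e.eval σ) ≤ e.mag * B := by
  induction e with
  | const c => exact Nat.le_mul_of_pos_right _ h.one_le
  | get a i _ => simpa [mag] using h a _
  | op o x y hx hy =>
    rw [mag, Nat.add_mul]
    refine le_trans ?_ (Nat.add_le_add hx hy)
    cases o with
    | add => exact bitLen_add_le _ _
    | sub => exact bitLen_sub_le _ _
    | mul => exact bitLen_mul_le _ _
    | div => exact (bitLen_div_le _ _).trans (Nat.le_add_right _ _)

theorem Exp.cost_le {σ : State} {B : ℕ} (h : σ.Bounded B) (e : Exp) :
    e.cost σ ≤ e.weight * B := by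
  induction e with
  | const c => exact Nat.le_mul_of_pos_right _ h.one_le
  | get a i hi =>
    rw [weight, cost, Nat.add_mul, one_mul]
    exact Nat.add_le_add hi (h a _)
  | op o x y hx hy =>
    have := Exp.bitLen_eval_le h (.op o x y)
    rw [weight, cost, Nat.add_mul, Nat.add_mul]
    exact Nat.add_le_add (Nat.add_le_add hx hy) this

/-! ### Filling a table -/

/-- The content of cell 0 of array `c`. -/
def Exp.var (c : ℕ) : Exp := .get c (.const 0)

@[simp] theorem Exp.eval_var (σ : State) (c : ℕ) : (Exp.var c).eval σ = σ c 0 := rfl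

/-- Starting with counter `c`, which counts to `N`: write the values of `E` to the cells of
array `a` from cell `base` on. -/
def fill (a c : ℕ) (N base E : Exp) : Prog :=
  .whilePos (N - .var c)
    (.seq (.assign a (base + .var c) E) (.assign c (.const 0) (.var c + .const 1)))

/-- Bounds the cost of one round in units of the cell length B. The 4 pays the unit charges of the
loop, the sequence and the two assignments. -/
def fillWeight (c : ℕ) (N base E : Exp) : ℕ :=
  (N - .var c).weight + (base + .var c).weight + E.weight + (Exp.const 0).weight +
    (Exp.var c + .const 1).weight + 4

/-- The memory after `q` rounds of `fill`. -/
def filled (σ : State) (a c b : ℕ) (f : ℕ → ℤ) (q : ℕ) : State := fun d i =>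
  if d = c ∧ i = 0 then (q : ℤ)
  else if d = a ∧ b ≤ i ∧ i < b + q then f (i - b) else σ d i

theorem filled_of_ne {σ : State} {a c b : ℕ} {f : ℕ → ℤ} {q d : ℕ} (ha : d ≠ a) (hc : d ≠ c)
    (i : ℕ) : filled σ a c b f q d i = σ d i := by
  simp [filled, ha, hc]

theorem filled_counter {σ : State} {a c b : ℕ} {f : ℕ → ℤ} {q : ℕ} :
    filled σ a c b f q c 0 = q := by
  simp [filled]

theorem filled_new {σ : State} {a c b : ℕ} {f : ℕ → ℤ} {q i : ℕ} (hac : a ≠ c) (hi : i < q) :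
    filled σ a c b f q a (b + i) = f i := by
  simp [filled, hac, hi]

theorem filled_old {σ : State} {a c b : ℕ} {f : ℕ → ℤ} {q i : ℕ} (hac : a ≠ c) (hi : i < b) :
    filled σ a c b f q a i = σ a i := by
  have : ¬ b ≤ i := by omega
  simp [filled, hac, this]

theorem filled_zero {σ : State} {a c b : ℕ} {f : ℕ → ℤ} (h : σ c 0 = 0) :
    filled σ a c b f 0 = σ := by
  funext d i
  simp only [filled]
  split_ifs with h1 h2
  · obtain ⟨rfl, rfl⟩ := h1
    exact_mod_cast h.symm
  · omega
  · rfl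

theorem filled_bounded {σ : State} {a c b : ℕ} {f : ℕ → ℤ} {q B : ℕ} (hσ : σ.Bounded B)
    (hq : bitLen q ≤ B) (hf : ∀ i < q, bitLen (f i) ≤ B) :
    (filled σ a c b f q).Bounded B := by
  intro d i
  simp only [filled]
  split_ifs with h1 h2
  · exact hq
  · exact hf _ (by omega)
  · exact hσ d i

theorem write_bounded {σ : State} {a i : ℕ} {z : ℤ} {B : ℕ} (hσ : σ.Bounded B)
    (hz : bitLen z ≤ B) : (σ.write a i z).Bounded B := by
  intro d j
  by_cases hd : d = a
  · subst hd
    by_cases hj : j = i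
    · subst hj; simpa [State.write] using hz
    · simpa [State.write, hj] using hσ d j
  · simpa [State.write, hd] using hσ d j

theorem write_write_filled {σ : State} {a c b : ℕ} {f : ℕ → ℤ} {q : ℕ} (hac : a ≠ c) :
    ((filled σ a c b f q).write a (b + q) (f q)).write c 0 ((q : ℤ) + 1) =
      filled σ a c b f (q + 1) := by
  funext d i
  by_cases hc : d = c
  · subst hc
    by_cases hi : i = 0
    · subst hi; simp [State.write, filled]
    · simp [State.write, filled, hi, Ne.symm hac]
  · by_cases ha : d = a
    · subst ha
      by_cases hi : i = b + q
      · subst hi; simp [State.write, filled, hac]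
      · have : (b ≤ i ∧ i < b + (q + 1)) ↔ (b ≤ i ∧ i < b + q) := by omega
        simp [State.write, filled, hac, hi, this]
    · simp [State.write, filled, hc, ha]

/-- Induction on the number of remaining rounds. `E` is evaluated in the partly filled memory, so a
table may be defined by recursion on its own earlier cells. The limit z is an integer, possibly
negative, in which case no round takes place. -/
theorem exec_fill {a c : ℕ} (hac : a ≠ c) {N base E : Exp} {σ : State} (h0 : σ c 0 = 0)
    {n b B : ℕ} {z : ℤ} {f : ℕ → ℤ} (hz : z.toNat = n)
    (hN : ∀ q ≤ n, N.eval (filled σ a c b f q) = z)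
    (hb : ∀ q < n, base.eval (filled σ a c b f q) = b)
    (hE : ∀ q < n, E.eval (filled σ a c b f q) = f q)
    (hσ : σ.Bounded B) (hn : bitLen n ≤ B) (hf : ∀ i < n, bitLen (f i) ≤ B) :
    ∃ t, Exec (fill a c N base E) σ (filled σ a c b f n) t ∧
      t ≤ (n + 1) * (fillWeight c N base E * B) := by
  have hB1 := hσ.one_le
  have hbd : ∀ q ≤ n, (filled σ a c b f q).Bounded B := fun q hq =>
    filled_bounded hσ ((bitLen_natCast_mono hq).trans hn) fun i hi => hf i (by omega)
  suffices h : ∀ r q, q + r = n → ∃ t, Exec (fill a c N base E) (filled σ a c b f q)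
      (filled σ a c b f n) t ∧ t ≤ (r + 1) * (fillWeight c N base E * B) by
    simpa [filled_zero h0] using h n 0 (by omega)
  intro r
  induction r with
  | zero =>
    intro q hq
    obtain rfl : q = n := by omega
    refine ⟨_, Exec.whileFalse ?_, ?_⟩
    · rw [Exp.eval_sub, hN q le_rfl, Exp.eval_var, filled_counter]
      omega
    · have h1 := Exp.cost_le (hbd q le_rfl) (N - .var c)
      have h2 : ((N - .var c).weight + 1) * B ≤ fillWeight c N base E * B :=
        Nat.mul_le_mul_right _ (by unfold fillWeight; omega)
      rw [Nat.add_mul] at h2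
      omega
  | succ r ih =>
    intro q hq
    obtain ⟨t, ht, htB⟩ := ih (q + 1) (by omega)
    have hqn : q < n := by omega
    have hbq := hbd q hqn.le
    have hcond : 0 < (N - .var c).eval (filled σ a c b f q) := by
      rw [Exp.eval_sub, hN q hqn.le, Exp.eval_var, filled_counter]
      omega
    have e1 := Exec.assign (filled σ a c b f q) a (base + .var c) E
    have hi : ((base + .var c).eval (filled σ a c b f q)).toNat = b + q := by
      rw [Exp.eval_add, hb q hqn, Exp.eval_var, filled_counter]
      omega
    rw [hi, hE q hqn] at e1
    have hbw : ((filled σ a c b f q).write a (b + q) (f q)).Bounded B :=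
      write_bounded hbq (hf q hqn)
    have e2 := Exec.assign ((filled σ a c b f q).write a (b + q) (f q)) c (.const 0)
      (.var c + .const 1)
    have hv : (Exp.var c + .const 1).eval ((filled σ a c b f q).write a (b + q) (f q)) =
        (q : ℤ) + 1 := by
      rw [Exp.eval_add, Exp.eval_var, Exp.eval_const, State.write,
        Function.update_of_ne (Ne.symm hac), filled_counter]
    rw [hv, Exp.eval_const, Int.toNat_zero, write_write_filled hac] at e2
    refine ⟨_, Exec.whileTrue hcond (Exec.seq e1 e2) ht, ?_⟩
    have c1 := Exp.cost_le hbq (N - .var c)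
    have c2 := Exp.cost_le hbq (base + .var c)
    have c3 := Exp.cost_le hbq E
    have c4 := Exp.cost_le hbw (.const 0)
    have c5 := Exp.cost_le hbw (.var c + .const 1)
    have h2 : fillWeight c N base E * B = (N - .var c).weight * B +
        (base + .var c).weight * B + E.weight * B + (Exp.const 0).weight * B +
        (Exp.var c + .const 1).weight * B + 4 * B := by
      unfold fillWeight
      ring
    have h3 : (r + 1 + 1) * (fillWeight c N base E * B) =
        (r + 1) * (fillWeight c N base E * B) + fillWeight c N base E * B := by ring
    rw [h3]
    omega

/-! ### Derived expressions -/

/-- Remainder. -/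
def Exp.mod (x y : Exp) : Exp := x - y * (x / y)

@[simp] theorem Exp.eval_mod (σ : State) (x y : Exp) :
    (x.mod y).eval σ = x.eval σ % y.eval σ := by
  simp [Exp.mod, Int.emod_def]

/-- `1` if the values agree, and `0` otherwise. -/
def Exp.delta (x y : Exp) : Exp := .const 1 / (.const 1 + (x - y) * (x - y))

-- Integer division of 1 by 1 + d² gives 0 unless d = 0, so equality is tested without branching.
@[simp] theorem Exp.eval_delta (σ : State) (x y : Exp) :
    (x.delta y).eval σ = if x.eval σ = y.eval σ then 1 else 0 := by
  simp only [Exp.delta, eval_div, eval_add, eval_sub, eval_mul, eval_const]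
  split_ifs with h
  · simp [h]
  · have : 0 < (x.eval σ - y.eval σ) * (x.eval σ - y.eval σ) :=
      mul_self_pos.2 (sub_ne_zero.2 h)
    exact Int.ediv_eq_zero_of_lt (by norm_num) (by omega)

end RAM

/-! ### Instances and their input cells -/

namespace SCGInstance

variable (x : SCGInstance)

theorem input_zero_zero : x.input 0 0 = x.n := rfl
theorem input_zero_one : x.input 0 1 = x.m := rfl
theorem input_one (j : ℕ) :
    x.input 1 j = if h : j < x.m then ((x.src ⟨j, h⟩ : ℕ) : ℤ) else 0 := rfl
theorem input_two (j : ℕ) :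
    x.input 2 j = if h : j < x.m then ((x.tgt ⟨j, h⟩ : ℕ) : ℤ) else 0 := rfl
theorem input_three (j : ℕ) :
    x.input 3 j = if h : j < x.m then (x.G.mult (x.pair ⟨j, h⟩) : ℤ) else 0 := rfl
theorem input_of_four_le {a : ℕ} (ha : 4 ≤ a) (i : ℕ) : x.input a i = 0 := by
  obtain ⟨a, rfl⟩ := Nat.exists_eq_add_of_le' ha
  rfl

/-! ### Sizes -/

theorem n_pos : 0 < x.n := by
  obtain ⟨v⟩ := x.connected.nonempty
  exact v.pos

/-- As n is given in binary, only connectedness makes n itself, and not just its length, bounded by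
the input size. -/
theorem n_le : x.n ≤ x.m + 1 := by
  have h1 := x.connected.card_vert_le_card_edgeSet_add_one
  have h2 : Nat.card x.G.graph.edgeSet = x.m := by
    rw [← x.enum.image_eq, Set.image_univ,
      Nat.card_range_of_injective (Set.injOn_univ.1 x.enum.injOn), Nat.card_eq_fintype_card,
      Fintype.card_fin]
  rwa [h2, Nat.card_eq_fintype_card, Fintype.card_fin] at h1

theorem m_add_two_le_size : x.m + 2 ≤ x.size := by
  have h1 := RAM.one_le_bitLen x.n
  have h2 := RAM.one_le_bitLen x.m
  have h3 : ∑ _j : Fin x.m, 1 ≤ ∑ j : Fin x.m, (RAM.bitLen (x.src j : ℕ) +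
      RAM.bitLen (x.tgt j : ℕ) + RAM.bitLen (x.G.mult (x.pair j))) :=
    Finset.sum_le_sum fun j _ => by
      have := RAM.one_le_bitLen (x.src j : ℕ)
      omega
  rw [Finset.sum_const, Finset.card_univ, Fintype.card_fin, smul_eq_mul, mul_one] at h3
  unfold size
  omega

theorem bitLen_edge_le (j : Fin x.m) : RAM.bitLen (x.src j : ℕ) + RAM.bitLen (x.tgt j : ℕ) +
    RAM.bitLen (x.G.mult (x.pair j)) ≤ x.size :=
  (Finset.single_le_sum (f := fun j : Fin x.m => RAM.bitLen (x.src j : ℕ) +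
    RAM.bitLen (x.tgt j : ℕ) + RAM.bitLen (x.G.mult (x.pair j)))
    (fun _ _ => Nat.zero_le _) (Finset.mem_univ j)).trans (Nat.le_add_left _ _)

theorem input_bounded : x.input.Bounded x.size := by
  have h0 : RAM.bitLen 0 ≤ x.size := by
    have := x.m_add_two_le_size
    simp [RAM.bitLen]
    omega
  intro a i
  match a, i with
  | 0, 0 => rw [input_zero_zero]; unfold size; omega
  | 0, 1 => rw [input_zero_one]; unfold size; omega
  | 0, i + 2 => exact h0
  | 1, j =>
    rw [input_one]
    split_ifs with h
    · have := x.bitLen_edge_le ⟨j, h⟩; omega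
    · exact h0
  | 2, j =>
    rw [input_two]
    split_ifs with h
    · have := x.bitLen_edge_le ⟨j, h⟩; omega
    · exact h0
  | 3, j =>
    rw [input_three]
    split_ifs with h
    · have := x.bitLen_edge_le ⟨j, h⟩; omega
    · exact h0
  | a + 4, i => exact h0

/-! ### The Laplacian in terms of the input -/

/-- The incidence vector of the `j`-th underlying edge; it is 0 for `j ≥ m`. -/
def inc (j i : ℕ) : ℤ :=
  (if (i : ℤ) = x.input 1 j then 1 else 0) - (if (i : ℤ) = x.input 2 j then 1 else 0)

/-- The Laplacian of the first `e` underlying edges. -/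
def lap (e i l : ℕ) : ℤ := ∑ j ∈ Finset.range e, x.input 3 j * (x.inc j i * x.inc j l)

/-- The Laplacian, after the multiplicity of the `j`-th underlying edge was increased by 1. -/
def block (j i l : ℕ) : ℤ := x.lap x.m i l + x.inc j i * x.inc j l

theorem inc_mul_inc (j : Fin x.m) (i l : Fin x.n) :
    x.inc j i * x.inc j l = (x.pair j).incidenceVec i * (x.pair j).incidenceVec l := by
  rw [pair, Sym2.incidenceVec_mk_mul]
  simp [inc, input_one, input_two, Fin.ext_iff]

/-- Both end cells beyond the list hold 0, so the indicators cancel. Index m thus stands for the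
unchanged graph, and t(G) comes out of the same loop as the minors of the edges. -/
theorem inc_m (i : ℕ) : x.inc x.m i = 0 := by
  simp [inc, input_one, input_two]

/-- The list meets each underlying edge exactly once, and the remaining pairs have multiplicity 0.
-/
theorem lap_eq (i l : Fin x.n) : x.lap x.m i l = x.G.laplacian i l := by
  rw [Multigraph.laplacian_apply_eq_sum, lap,
    ← Fin.sum_univ_eq_sum_range (fun j => x.input 3 j * (x.inc j i * x.inc j l))]
  have h1 : ∀ j : Fin x.m, x.input 3 j * (x.inc j i * x.inc j l) =
      (fun z : Sym2 (Fin x.n) => (x.G.mult z : ℤ) * (z.incidenceVec i * z.incidenceVec l))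
        (x.pair j) := by
    intro j
    rw [inc_mul_inc]
    simp [input_three]
  rw [Finset.sum_congr rfl fun j _ => h1 j]
  refine (Finset.sum_image (s := Finset.univ) (g := x.pair)
    (f := fun z => (x.G.mult z : ℤ) * (z.incidenceVec i * z.incidenceVec l)) fun j _ k _ h =>
      Set.injOn_univ.1 x.enum.injOn h).symm.trans ?_
  refine Finset.sum_subset (Finset.subset_univ _) fun z _ hz => ?_
  have : x.G.mult z = 0 := by
    by_contra h
    obtain ⟨j, -, hj⟩ := x.enum.surjOn ((x.G.mult_pos_iff z).1 (Nat.pos_of_ne_zero h))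
    exact hz (Finset.mem_image.2 ⟨j, Finset.mem_univ j, hj⟩)
  simp [this]

/-- Only a diagonal cofactor is used, so H may be disconnected, as G ∖ e is for a bridge e. -/
theorem treeCount_eq_leadingMinor (H : Multigraph (Fin x.n)) (A : ℕ → ℕ → ℤ)
    (h : ∀ i l : Fin x.n, A i l = H.laplacian i l) :
    (H.treeCount : ℤ) = leadingMinor A (x.n - 1) := by
  have hn := x.n_pos
  rw [← Matrix.adjugate_last_eq_leadingMinor (⟨x.n - 1, by omega⟩ : Fin x.n)
    (by simp only; omega) H.laplacian A (fun i l => (h i l).symm),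
    Multigraph.adjugate_laplacian_self]

theorem leadingMinor_block_m :
    leadingMinor (x.block x.m) (x.n - 1) = x.G.treeCount := by
  rw [x.treeCount_eq_leadingMinor x.G (x.block x.m) fun i l => by
    rw [block, inc_m, zero_mul, add_zero, lap_eq]]

/-- Starting from G ∖ e, the minor is affine in the number c of added copies of e; c = 0, 1, 2 give
G ∖ e, G and `block j`. -/
theorem leadingMinor_block (j : Fin x.m) (k : Fin (x.G.mult (x.pair j))) :
    leadingMinor (x.block j) (x.n - 1) =
      2 * x.G.treeCount - (x.G.deleteEdge ⟨x.pair j, k⟩).treeCount := by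
  obtain ⟨d, hd⟩ := exists_leadingMinor_add_mul
    (fun i l => x.lap x.m i l + (-1) * (x.inc j i * x.inc j l)) (x.inc j) (x.n - 1)
  have h0 := x.treeCount_eq_leadingMinor (x.G.deleteEdge ⟨x.pair j, k⟩)
    (fun i l => x.lap x.m i l + (-1) * (x.inc j i * x.inc j l)) fun i l => by
      rw [Multigraph.laplacian_deleteEdge_apply, inc_mul_inc, lap_eq]; ring
  have h1 := x.treeCount_eq_leadingMinor x.G (x.lap x.m) x.lap_eq
  have h2 := hd 1
  have h3 := hd 2
  rw [h0, h1]
  have e1 : (fun i l => x.lap x.m i l + (-1) * (x.inc j i * x.inc j l) +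
      1 * (x.inc j i * x.inc j l)) = x.lap x.m := by
    funext i l; ring
  have e2 : (fun i l => x.lap x.m i l + (-1) * (x.inc j i * x.inc j l) +
      2 * (x.inc j i * x.inc j l)) = x.block j := by
    funext i l; rw [block]; ring
  rw [e1] at h2
  rw [e2] at h3
  rw [h2, h3]
  ring

theorem leadingMinor_block_ne_zero (j : ℕ) {k : ℕ} (hk : k < x.n) :
    leadingMinor (x.block j) k ≠ 0 :=
  Multigraph.leadingMinor_laplacian_ne_zero x.connected (x.lap x.m) x.lap_eq (x.inc j) hk

/-- The nonvanishing minor of order n - 1 replaces the construction of a spanning tree. -/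
theorem treeCount_pos : 0 < x.G.treeCount := by
  have h := x.leadingMinor_block_ne_zero x.m (Nat.sub_lt x.n_pos one_pos)
  rw [leadingMinor_block_m] at h
  exact Nat.pos_of_ne_zero (by exact_mod_cast h)

/-! ### Bounds -/

theorem abs_inc_le (j i : ℕ) : |x.inc j i| ≤ 1 := by
  unfold inc
  split_ifs <;> simp

theorem abs_inc_mul_inc_le (j i l : ℕ) : |x.inc j i * x.inc j l| ≤ 1 := by
  rw [abs_mul]
  exact mul_le_one₀ (x.abs_inc_le j i) (abs_nonneg _) (x.abs_inc_le j l)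

theorem abs_lap_le {e : ℕ} (he : e ≤ x.m) (i l : ℕ) : |x.lap e i l| ≤ x.m * 2 ^ x.size := by
  have h : ∀ j ∈ Finset.range e, |x.input 3 j * (x.inc j i * x.inc j l)| ≤ 2 ^ x.size := by
    intro j _
    rw [abs_mul]
    have h1 := x.abs_inc_mul_inc_le j i l
    have h2 : |x.input 3 j| ≤ 2 ^ x.size := by
      have h3 : (x.input 3 j).natAbs < 2 ^ x.size :=
        RAM.bitLen_le_iff.1 ((x.input_bounded 3 j).trans (Nat.le_succ _))
      rw [← Int.natCast_natAbs]
      exact_mod_cast h3.le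
    nlinarith [abs_nonneg (x.input 3 j), abs_nonneg (x.inc j i * x.inc j l)]
  refine (Finset.abs_sum_le_sum_abs _ _).trans ((Finset.sum_le_sum h).trans ?_)
  rw [Finset.sum_const, Finset.card_range, nsmul_eq_mul]
  exact mul_le_mul_of_nonneg_right (by exact_mod_cast he) (by positivity)

theorem m_add_one_mul_le : ((x.m : ℤ) + 1) * 2 ^ x.size ≤ 2 ^ (2 * x.size) := by
  have h1 : x.m + 1 ≤ 2 ^ x.size := by
    have := x.m_add_two_le_size
    have := Nat.lt_two_pow_self (n := x.size)
    omega
  rw [two_mul, pow_add]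
  exact mul_le_mul_of_nonneg_right (by exact_mod_cast h1) (by positivity)

theorem abs_lap_le_two_pow {e : ℕ} (he : e ≤ x.m) (i l : ℕ) :
    |x.lap e i l| ≤ 2 ^ (2 * x.size) := by
  have h1 := x.abs_lap_le he i l
  have h2 := x.m_add_one_mul_le
  have h3 : (0 : ℤ) < 2 ^ x.size := by positivity
  linarith

theorem abs_block_le (j i l : ℕ) : |x.block j i l| ≤ 2 ^ (2 * x.size) := by
  have h1 := x.abs_lap_le le_rfl i l
  have h2 := x.abs_inc_mul_inc_le j i l
  have h3 := abs_add_le (x.lap x.m i l) (x.inc j i * x.inc j l)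
  have h4 := x.m_add_one_mul_le
  have h5 : (1 : ℤ) ≤ 2 ^ x.size := one_le_pow₀ (by norm_num)
  unfold block
  linarith

/-- With s the size and k + 1 ≤ s, the factorial contributes at most s² bits and the powers of the
entries at most 2s · s. -/
theorem abs_borderedMinor_block_le (j : ℕ) {k : ℕ} (hk : k < x.n) (i l : ℕ) :
    |borderedMinor (x.block j) k i l| ≤ 2 ^ (3 * x.size ^ 2) := by
  have hs : k + 1 ≤ x.size := by
    have := x.n_le
    have := x.m_add_two_le_size
    omega
  refine (abs_borderedMinor_le _ _ (x.abs_block_le j) k i l).trans ?_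
  have h1 : (k + 1).factorial ≤ 2 ^ (x.size ^ 2) := by
    calc (k + 1).factorial ≤ (k + 1) ^ (k + 1) := Nat.factorial_le_pow _
      _ ≤ (2 ^ x.size) ^ (k + 1) :=
        Nat.pow_le_pow_left (hs.trans Nat.lt_two_pow_self.le) _
      _ ≤ (2 ^ x.size) ^ x.size := Nat.pow_le_pow_right (by positivity) hs
      _ = 2 ^ (x.size ^ 2) := by rw [← pow_mul, sq]
  have h2 : ((2 : ℤ) ^ (2 * x.size)) ^ (k + 1) ≤ 2 ^ (2 * x.size ^ 2) := by
    rw [← pow_mul]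
    refine pow_le_pow_right₀ (by norm_num) ?_
    nlinarith
  calc ((k + 1).factorial : ℤ) * (2 ^ (2 * x.size)) ^ (k + 1)
      ≤ 2 ^ (x.size ^ 2) * 2 ^ (2 * x.size ^ 2) :=
        mul_le_mul (by exact_mod_cast h1) h2 (by positivity) (by positivity)
    _ = 2 ^ (3 * x.size ^ 2) := by rw [← pow_add]; congr 1; ring

theorem abs_leadingMinor_block_le (j : ℕ) :
    |leadingMinor (x.block j) (x.n - 1)| ≤ 2 ^ (3 * x.size ^ 2) := by
  have hn := x.n_pos
  rcases Nat.eq_zero_or_pos (x.n - 1) with h | h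
  · rw [h, leadingMinor_zero, abs_one]
    exact one_le_pow₀ (by norm_num)
  · rw [show x.n - 1 = (x.n - 2) + 1 by omega, ← borderedMinor_self]
    exact x.abs_borderedMinor_block_le j (by omega) _ _

end SCGInstance

namespace SCGInstance

open RAM

variable (x : SCGInstance)

/-! ### Tables of minors -/

/-- Layer `e` of this table of matrices is the Laplacian of the first `e` underlying edges. -/
def lapTable (r : ℕ) : ℤ := x.lap (r / (x.n * x.n)) (r / x.n % x.n) (r % x.n)

/-- The number of entries in a layer of `minorTable`. -/
def layer : ℕ := (x.m + 1) * (x.n * x.n)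

/-- Layer `k` of this table holds for every `j ≤ m` the bordered minors of order `k + 1` of
`block j`. -/
def minorTable (r : ℕ) : ℤ :=
  borderedMinor (x.block (r / (x.n * x.n) % (x.m + 1))) (r / x.layer) (r / x.n % x.n) (r % x.n)

theorem lapTable_of_lt {r : ℕ} (hr : r < x.n * x.n) : x.lapTable r = 0 := by
  simp [lapTable, Nat.div_eq_of_lt hr, lap]

/-- The recursion run by the program: one layer back, plus the contribution of one edge. -/
theorem lapTable_add (q : ℕ) : x.lapTable (x.n * x.n + q) = x.lapTable q +
    x.input 3 (q / (x.n * x.n)) * (x.inc (q / (x.n * x.n)) (q / x.n % x.n) *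
      x.inc (q / (x.n * x.n)) (q % x.n)) := by
  have hn := x.n_pos
  have h1 : (x.n * x.n + q) / (x.n * x.n) = q / (x.n * x.n) + 1 :=
    Nat.add_div_left _ (Nat.mul_pos hn hn)
  have h2 : (x.n * x.n + q) / x.n % x.n = q / x.n % x.n := by
    rw [Nat.mul_add_div hn, Nat.add_mod_left]
  have h3 : (x.n * x.n + q) % x.n = q % x.n := Nat.mul_add_mod _ _ _
  rw [lapTable, h1, h2, h3, lap, Finset.sum_range_succ]
  rfl

theorem lapTable_last {q : ℕ} :
    x.lapTable (x.m * (x.n * x.n) + q % (x.n * x.n)) = x.lap x.m (q / x.n % x.n) (q % x.n) := by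
  have hn := x.n_pos
  have h1 : (x.m * (x.n * x.n) + q % (x.n * x.n)) / (x.n * x.n) = x.m := by
    rw [mul_comm, Nat.mul_add_div (Nat.mul_pos hn hn),
      Nat.div_eq_of_lt (Nat.mod_lt _ (Nat.mul_pos hn hn)), add_zero]
  have h2 : (x.m * (x.n * x.n) + q % (x.n * x.n)) / x.n % x.n = q / x.n % x.n := by
    rw [show x.m * (x.n * x.n) = x.n * (x.n * x.m) by ring, Nat.mul_add_div hn,
      Nat.mul_add_mod, Nat.mod_mul_right_div_self, Nat.mod_mod]
  have h3 : (x.m * (x.n * x.n) + q % (x.n * x.n)) % x.n = q % x.n := by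
    rw [show x.m * (x.n * x.n) = x.n * (x.n * x.m) by ring, Nat.mul_add_mod,
      Nat.mod_mul_right_mod]
  rw [lapTable, h1, h2, h3]

/-- Positions are written in mixed radix, with digits l and i in base n, then j in base m + 1, and k
on top. -/
theorem minorTable_index {j i l : ℕ} (hj : j ≤ x.m) (hi : i < x.n) (hl : l < x.n) (k : ℕ) :
    x.minorTable (k * x.layer + j * (x.n * x.n) + (i * x.n + l)) =
      borderedMinor (x.block j) k i l := by
  have hn := x.n_pos
  set r := k * x.layer + j * (x.n * x.n) + (i * x.n + l) with hr
  have e : r = x.n * (x.n * ((x.m + 1) * k + j) + i) + l := by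
    rw [hr, layer]; ring
  have h1 : r / x.n = x.n * ((x.m + 1) * k + j) + i := by
    rw [e, Nat.mul_add_div hn, Nat.div_eq_of_lt hl, add_zero]
  have h2 : r % x.n = l := by
    rw [e, Nat.mul_add_mod, Nat.mod_eq_of_lt hl]
  have h3 : r / (x.n * x.n) = (x.m + 1) * k + j := by
    rw [← Nat.div_div_eq_div_mul, h1, Nat.mul_add_div hn, Nat.div_eq_of_lt hi, add_zero]
  have h4 : r / x.layer = k := by
    rw [layer, mul_comm (x.m + 1), ← Nat.div_div_eq_div_mul, h3, Nat.mul_add_div (by omega),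
      Nat.div_eq_of_lt (by omega), add_zero]
  rw [minorTable, h4, h3, h2, h1, Nat.mul_add_mod, Nat.mod_eq_of_lt (by omega : j < x.m + 1),
    Nat.mul_add_mod, Nat.mod_eq_of_lt hi]

theorem index_decomposition (q : ℕ) :
    q / x.layer * x.layer + q / (x.n * x.n) % (x.m + 1) * (x.n * x.n) +
      (q / x.n % x.n * x.n + q % x.n) = q := by
  have h1 := Nat.div_add_mod q x.n
  have h2 := Nat.div_add_mod (q / x.n) x.n
  have h3 := Nat.div_add_mod (q / (x.n * x.n)) (x.m + 1)
  rw [Nat.div_div_eq_div_mul] at h2 h3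
  have h4 : q / x.layer = q / (x.n * x.n * (x.m + 1)) := by rw [layer, mul_comm]
  rw [h4, layer]
  nlinarith

theorem index_lt {j i l : ℕ} (hj : j ≤ x.m) (hi : i < x.n) (hl : l < x.n) :
    j * (x.n * x.n) + (i * x.n + l) < x.layer := by
  have h1 : i * x.n + l < x.n * x.n := by nlinarith
  have h2 : j * (x.n * x.n) ≤ x.m * (x.n * x.n) := Nat.mul_le_mul_right _ hj
  rw [layer, Nat.add_mul, one_mul]
  omega

/-- Advancing by one layer raises the order and keeps j, i, l, so this is one elimination step for
all matrices. -/
theorem minorTable_add_layer {q : ℕ} (hq : q / x.layer < x.n) :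
    x.minorTable (x.layer + q) =
      (borderedMinor (x.block (q / (x.n * x.n) % (x.m + 1))) (q / x.layer) (q / x.layer)
          (q / x.layer) * x.minorTable q -
        borderedMinor (x.block (q / (x.n * x.n) % (x.m + 1))) (q / x.layer) (q / x.n % x.n)
            (q / x.layer) *
          borderedMinor (x.block (q / (x.n * x.n) % (x.m + 1))) (q / x.layer) (q / x.layer)
            (q % x.n)) /
        leadingMinor (x.block (q / (x.n * x.n) % (x.m + 1))) (q / x.layer) := by
  have hn := x.n_pos
  have h := x.minorTable_index (Nat.lt_succ_iff.1 (Nat.mod_lt (q / (x.n * x.n)) x.m.succ_pos))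
    (Nat.mod_lt (q / x.n) hn) (Nat.mod_lt q hn) (q / x.layer + 1)
  have e : (q / x.layer + 1) * x.layer + q / (x.n * x.n) % (x.m + 1) * (x.n * x.n) +
      (q / x.n % x.n * x.n + q % x.n) = x.layer + q := by
    have := x.index_decomposition q
    rw [Nat.add_mul, one_mul]
    omega
  rw [Nat.succ_eq_add_one, e] at h
  rw [h, borderedMinor_succ _ _ _ _ (x.leadingMinor_block_ne_zero _ hq)]
  rfl

/-- The place of the pivots, if the table of minors is preceded by ones. -/
theorem pivot_eq {T : ℕ → ℤ} {R : ℕ} (h1 : ∀ r < x.n + 1 + x.layer, T r = 1)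
    (hT : ∀ r < R, T (x.n + 1 + x.layer + r) = x.minorTable r) {k j : ℕ} (hk : k < x.n)
    (hR : k * x.layer ≤ R) (hj : j ≤ x.m) :
    T (k * x.layer + j * (x.n * x.n) + k * (x.n + 1)) = leadingMinor (x.block j) k := by
  have hn := x.n_pos
  obtain _ | k := k
  · have := x.index_lt hj hn hn
    rw [leadingMinor_zero]
    exact h1 _ (by omega)
  · have hi := x.index_lt hj (by omega : k < x.n) (by omega : k < x.n)
    -- The pivot of order k + 1 is the diagonal entry (k, k) of layer k. A prefix of length n + 1 +
    -- `layer` makes one address formula valid for every order, with order 0 falling into the ones.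
    have e : (k + 1) * x.layer + j * (x.n * x.n) + (k + 1) * (x.n + 1) =
        x.n + 1 + x.layer + (k * x.layer + j * (x.n * x.n) + (k * x.n + k)) := by ring
    rw [Nat.add_mul, one_mul] at hR
    rw [e, hT _ (by omega), x.minorTable_index hj (by omega) (by omega), borderedMinor_self]

/-! ### Bounds for the number of steps and for the cells -/

/-- A bound for the bit lengths of all cells. -/
def bound : ℕ := 10 * (x.size + 1) ^ 4

theorem le_bound {a : ℕ} (h : a ≤ 10 * (x.size + 1) ^ 4) : a ≤ x.bound := h

theorem n_add_one_le_size : x.n + 1 ≤ x.size := by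
  have := x.n_le
  have := x.m_add_two_le_size
  omega

theorem sq_n_le : x.n * x.n ≤ (x.size + 1) ^ 2 := by
  have := x.n_add_one_le_size
  rw [sq]
  exact Nat.mul_le_mul (by omega) (by omega)

theorem layer_le : x.layer ≤ (x.size + 1) ^ 3 := by
  have := x.m_add_two_le_size
  rw [layer, pow_succ']
  exact Nat.mul_le_mul (by omega) x.sq_n_le

theorem size_pow_le {i : ℕ} (hi : i ≤ 4) : (x.size + 1) ^ i ≤ (x.size + 1) ^ 4 :=
  Nat.pow_le_pow_right (by omega) hi

theorem bitLen_le_bound {z : ℤ} (h : |z| ≤ 2 ^ (3 * x.size ^ 2 + x.size + 2)) :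
    bitLen z ≤ x.bound := by
  refine (bitLen_le_of_abs_le h).trans (x.le_bound ?_)
  have h1 := x.size_pow_le (i := 2) (by norm_num)
  have h2 := x.size_pow_le (i := 0) (by norm_num)
  nlinarith

theorem two_pow_le_two_pow {a b : ℕ} (h : a ≤ b) : (2 : ℤ) ^ a ≤ 2 ^ b :=
  pow_le_pow_right₀ (by norm_num) h

theorem bitLen_lapTable_le {r : ℕ} (hr : r < x.layer) : bitLen (x.lapTable r) ≤ x.bound := by
  have he : r / (x.n * x.n) ≤ x.m :=
    Nat.lt_succ_iff.1 (Nat.div_lt_of_lt_mul (by rwa [mul_comm, ← layer]))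
  refine x.bitLen_le_bound ((x.abs_lap_le_two_pow he _ _).trans (two_pow_le_two_pow ?_))
  nlinarith [x.m_add_two_le_size]

theorem bitLen_minorTable_le {r : ℕ} (hr : r / x.layer < x.n) :
    bitLen (x.minorTable r) ≤ x.bound :=
  x.bitLen_le_bound ((x.abs_borderedMinor_block_le _ hr _ _).trans
    (two_pow_le_two_pow (by omega)))

/-! ### Memories between the steps -/

/-- The memory holds the input and is bounded, and the counters from `c` on are 0. -/
structure Ready (c : ℕ) (σ : State) : Prop where
  input : ∀ a < 4, ∀ i, σ a i = x.input a i
  bounded : σ.Bounded x.bound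
  counter : ∀ d, c ≤ d → σ d 0 = 0

theorem ready_input : x.Ready 8 x.input where
  input _ _ _ := rfl
  bounded a i := (x.input_bounded a i).trans (x.le_bound (by
    have := x.size_pow_le (i := 1) (by norm_num)
    rw [pow_one] at this
    omega))
  counter d hd := x.input_of_four_le (by omega) 0

variable {x}

/-- The number of rounds and the cost of a round are each at most linear in `bound`, whence the
square. Arrays below 4 are never written, so limits and base addresses computed from the input stay
fixed; each loop uses up one fresh counter. -/
theorem Ready.exec_fill {a c : ℕ} {N base E : Exp} {σ : State} (hσ : x.Ready c σ)
    (ha : 4 ≤ a) (hac : a < c) {k b : ℕ} {z : ℤ} {f : ℕ → ℤ} (hz : z.toNat = k)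
    (hN : ∀ τ : State, (∀ a < 4, ∀ i, τ a i = x.input a i) → N.eval τ = z)
    (hb : ∀ τ : State, (∀ a < 4, ∀ i, τ a i = x.input a i) → base.eval τ = b)
    (hE : ∀ q < k, (∀ d < 4, ∀ i, filled σ a c b f q d i = x.input d i) →
      E.eval (filled σ a c b f q) = f q)
    (hk : k + 1 ≤ x.bound) (hf : ∀ i < k, bitLen (f i) ≤ x.bound) :
    ∃ t, Exec (fill a c N base E) σ (filled σ a c b f k) t ∧
      t ≤ fillWeight c N base E * x.bound ^ 2 ∧ x.Ready (c + 1) (filled σ a c b f k) := by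
  have hin : ∀ q, ∀ d < 4, ∀ i, filled σ a c b f q d i = x.input d i := by
    intro q d hd i
    rw [filled_of_ne (by omega) (by omega)]
    exact hσ.input d hd i
  have hkb : bitLen k ≤ x.bound := (bitLen_natCast_le k).trans hk
  obtain ⟨t, ht, htb⟩ := RAM.exec_fill (N := N) (base := base) (E := E) hac.ne
    (hσ.counter c le_rfl) hz (fun q _ => hN _ (hin q)) (fun q _ => hb _ (hin q))
    (fun q hq => hE q hq (hin q)) hσ.bounded hkb hf
  refine ⟨t, ht, htb.trans ?_, hin k, filled_bounded hσ.bounded hkb hf, fun d hd => ?_⟩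
  · calc (k + 1) * (fillWeight c N base E * x.bound)
        ≤ x.bound * (fillWeight c N base E * x.bound) := Nat.mul_le_mul_right _ hk
      _ = fillWeight c N base E * x.bound ^ 2 := by ring
  · rw [filled_of_ne (by omega) (by omega)]
    exact hσ.counter d (by omega)

end SCGInstance

namespace SCGInstance

open RAM

variable {x : SCGInstance}

/-! ### The expressions of the programs -/

def nExp : Exp := .get 0 (.const 0)
def mExp : Exp := .get 0 (.const 1)
def sqExp : Exp := nExp * nExp
def layerExp : Exp := (mExp + .const 1) * sqExp
def rowExp (c : ℕ) : Exp := (Exp.var c / nExp).mod nExp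
def colExp (c : ℕ) : Exp := (Exp.var c).mod nExp
def incExp (j i : Exp) : Exp := i.delta (.get 1 j) - i.delta (.get 2 j)

theorem eval_get_of_eq {τ : State} {i : Exp} {k : ℕ} (a : ℕ) (h : i.eval τ = k) :
    (Exp.get a i).eval τ = τ a k := by
  rw [Exp.eval_get, h, Int.toNat_natCast]

section Eval

variable {τ : State} (h : ∀ a < 4, ∀ i, τ a i = x.input a i)
include h

theorem eval_nExp : nExp.eval τ = x.n := h 0 (by norm_num) 0
theorem eval_mExp : mExp.eval τ = x.m := h 0 (by norm_num) 1

theorem eval_sqExp : sqExp.eval τ = (x.n * x.n : ℕ) := by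
  rw [sqExp, Exp.eval_mul, eval_nExp h, Nat.cast_mul]

theorem eval_layerExp : layerExp.eval τ = x.layer := by
  rw [layerExp, Exp.eval_mul, Exp.eval_add, eval_mExp h, eval_sqExp h, layer]
  push_cast
  rfl

theorem eval_rowExp {c q : ℕ} (hq : τ c 0 = q) :
    (rowExp c).eval τ = (q / x.n % x.n : ℕ) := by
  simp [rowExp, eval_nExp h, hq]

theorem eval_colExp {c q : ℕ} (hq : τ c 0 = q) : (colExp c).eval τ = (q % x.n : ℕ) := by
  simp [colExp, eval_nExp h, hq]

theorem eval_incExp {j i : Exp} {j' i' : ℕ} (hj : j.eval τ = j') (hi : i.eval τ = i') :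
    (incExp j i).eval τ = x.inc j' i' := by
  rw [incExp, Exp.eval_sub, Exp.eval_delta, Exp.eval_delta, eval_get_of_eq 1 hj,
    eval_get_of_eq 2 hj, hi, h 1 (by norm_num), h 2 (by norm_num), inc]

end Eval

/-! ### The Laplacian -/

/-- Writing starts at cell n², so the cell at the counter is exactly one layer behind; layer 0 is
the initial zero memory. -/
def lapExp : Exp :=
  .get 6 (.var 8) + .get 3 (.var 8 / sqExp) *
    (incExp (.var 8 / sqExp) (rowExp 8) * incExp (.var 8 / sqExp) (colExp 8))

def lapProg : Prog := fill 6 8 (mExp * sqExp) sqExp lapExp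

theorem exec_lapProg (x : SCGInstance) : ∃ τ t, Exec lapProg x.input τ t ∧
    t ≤ fillWeight 8 (mExp * sqExp) sqExp lapExp * x.bound ^ 2 ∧ x.Ready 9 τ ∧ ∀ r < x.layer, τ 6 r = x.lapTable r := by
  have hlayer : x.m * (x.n * x.n) + x.n * x.n = x.layer := by rw [layer]; ring
  have hread : ∀ q r, r < x.n * x.n + q →
      filled x.input 6 8 (x.n * x.n) (fun i => x.lapTable (x.n * x.n + i)) q 6 r =
        x.lapTable r := by
    intro q r hr
    by_cases h : r < x.n * x.n
    · rw [filled_old (by norm_num) h, x.input_of_four_le (by norm_num), x.lapTable_of_lt h]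
    · obtain ⟨i, rfl⟩ := Nat.exists_eq_add_of_le (not_lt.1 h)
      exact filled_new (by norm_num) (by omega)
  obtain ⟨t, ht, htb, hr⟩ := x.ready_input.exec_fill (a := 6) (N := mExp * sqExp)
    (base := sqExp) (E := lapExp)
    (by norm_num) (by norm_num) (k := x.m * (x.n * x.n)) (b := x.n * x.n)
    (z := (x.m * (x.n * x.n) : ℕ)) (f := fun i => x.lapTable (x.n * x.n + i))
    (Int.toNat_natCast _)
    (fun τ h => by rw [Exp.eval_mul, eval_mExp h, eval_sqExp h]; push_cast; ring)
    (fun τ h => eval_sqExp h)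
    (fun q hq h => by
      have hc := filled_counter (σ := x.input) (a := 6) (c := 8) (b := x.n * x.n)
        (f := fun i => x.lapTable (x.n * x.n + i)) (q := q)
      have hj : (Exp.var 8 / sqExp).eval (filled x.input 6 8 (x.n * x.n)
          (fun i => x.lapTable (x.n * x.n + i)) q) = (q / (x.n * x.n) : ℕ) := by
        rw [Exp.eval_div, Exp.eval_var, hc, eval_sqExp h, Int.natCast_ediv]
      have hv : (Exp.var 8).eval (filled x.input 6 8 (x.n * x.n)
          (fun i => x.lapTable (x.n * x.n + i)) q) = q := hc
      rw [lapExp, Exp.eval_add, Exp.eval_mul, Exp.eval_mul,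
        eval_get_of_eq 6 hv, eval_get_of_eq 3 hj,
        eval_incExp h hj (eval_rowExp h hc), eval_incExp h hj (eval_colExp h hc),
        hread q q (Nat.lt_add_of_pos_left (Nat.mul_pos x.n_pos x.n_pos)), h 3 (by norm_num),
        lapTable_add])
    (x.le_bound (by
      have := x.layer_le
      have := x.size_pow_le (i := 3) (by norm_num)
      have : 1 ≤ (x.size + 1) ^ 4 := Nat.one_le_pow _ _ (by omega)
      omega))
    (fun i hi => x.bitLen_lapTable_le (by omega))
  exact ⟨_, t, ht, htb, hr, fun r hr' => hread _ _ (by omega)⟩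

/-! ### Fraction-free elimination -/

/-- The ones are the empty minors by which the first elimination step divides. -/
def onesProg : Prog := fill 7 9 (layerExp + nExp + .const 1) (.const 0) (.const 1)

theorem exec_onesProg {σ : State} (hσ : x.Ready 9 σ)
    (h6 : ∀ r < x.layer, σ 6 r = x.lapTable r) : ∃ τ t, Exec onesProg σ τ t ∧
    t ≤ fillWeight 9 (layerExp + nExp + .const 1) (.const 0) (.const 1) * x.bound ^ 2 ∧
    x.Ready 10 τ ∧ (∀ r < x.layer, τ 6 r = x.lapTable r) ∧
    ∀ r < x.n + 1 + x.layer, τ 7 r = 1 := by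
  obtain ⟨t, ht, htb, hr⟩ := hσ.exec_fill (a := 7) (N := layerExp + nExp + .const 1)
    (base := .const 0) (E := .const 1) (by norm_num) (by norm_num) (k := x.n + 1 + x.layer)
    (b := 0) (z := (x.n + 1 + x.layer : ℕ)) (f := fun _ => 1) (Int.toNat_natCast _)
    (fun τ h => by
      rw [Exp.eval_add, Exp.eval_add, eval_layerExp h, eval_nExp h, Exp.eval_const]
      push_cast
      ring)
    (fun τ h => rfl) (fun q hq h => rfl)
    (x.le_bound (by
      have := x.layer_le
      have := x.n_add_one_le_size
      have := x.size_pow_le (i := 3) (by norm_num)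
      have h1 := x.size_pow_le (i := 1) (by norm_num)
      have : 1 ≤ (x.size + 1) ^ 4 := Nat.one_le_pow _ _ (by omega)
      rw [pow_one] at h1
      omega))
    (fun i hi => x.bitLen_le_bound (by rw [abs_one]; exact one_le_pow₀ (by norm_num)))
  refine ⟨_, t, ht, htb, hr, fun r hr' => ?_, fun r hr' => ?_⟩
  · rw [filled_of_ne (by norm_num) (by norm_num), h6 r hr']
  · have := filled_new (σ := σ) (a := 7) (c := 9) (b := 0) (f := fun _ => 1) (by norm_num) hr'
    rwa [Nat.zero_add] at this

/-- The initial matrices of the eliminations. -/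
def blockExp : Exp :=
  .get 6 (mExp * sqExp + (Exp.var 10).mod sqExp) +
    incExp (.var 10 / sqExp) (rowExp 10) * incExp (.var 10 / sqExp) (colExp 10)

def blockProg : Prog := fill 7 10 layerExp (nExp + .const 1 + layerExp) blockExp

theorem minorTable_of_lt {q : ℕ} (hq : q < x.layer) :
    x.minorTable q = x.block (q / (x.n * x.n)) (q / x.n % x.n) (q % x.n) := by
  have : q / (x.n * x.n) < x.m + 1 := Nat.div_lt_of_lt_mul (by rwa [mul_comm, ← layer])
  rw [minorTable, Nat.div_eq_of_lt hq, borderedMinor_zero, Nat.mod_eq_of_lt this]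

theorem exec_blockProg {σ : State} (hσ : x.Ready 10 σ)
    (h6 : ∀ r < x.layer, σ 6 r = x.lapTable r)
    (h7 : ∀ r < x.n + 1 + x.layer, σ 7 r = 1) : ∃ τ t, Exec blockProg σ τ t ∧
    t ≤ fillWeight 10 layerExp (nExp + .const 1 + layerExp) blockExp * x.bound ^ 2 ∧
    x.Ready 11 τ ∧ (∀ r < x.n + 1 + x.layer, τ 7 r = 1) ∧
    ∀ r < x.layer, τ 7 (x.n + 1 + x.layer + r) = x.minorTable r := by
  have hsq : 0 < x.n * x.n := Nat.mul_pos x.n_pos x.n_pos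
  have hlayer : x.m * (x.n * x.n) + x.n * x.n = x.layer := by rw [layer]; ring
  obtain ⟨t, ht, htb, hr⟩ := hσ.exec_fill (a := 7) (N := layerExp)
    (base := nExp + .const 1 + layerExp) (E := blockExp) (by norm_num) (by norm_num)
    (k := x.layer) (b := x.n + 1 + x.layer) (z := x.layer) (f := x.minorTable)
    (Int.toNat_natCast _) (fun τ h => eval_layerExp h)
    (fun τ h => by
      rw [Exp.eval_add, Exp.eval_add, eval_layerExp h, eval_nExp h, Exp.eval_const]
      push_cast
      ring)
    (fun q hq h => by
      have hc := filled_counter (σ := σ) (a := 7) (c := 10) (b := x.n + 1 + x.layer)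
        (f := x.minorTable) (q := q)
      have hread : ∀ r, filled σ 7 10 (x.n + 1 + x.layer) x.minorTable q 6 r = σ 6 r :=
        filled_of_ne (by norm_num) (by norm_num)
      revert h hc hread
      generalize filled σ 7 10 (x.n + 1 + x.layer) x.minorTable q = τ
      intro h hc hread
      have hj : (Exp.var 10 / sqExp).eval τ = (q / (x.n * x.n) : ℕ) := by
        rw [Exp.eval_div, Exp.eval_var, hc, eval_sqExp h, Int.natCast_ediv]
      have ha : (mExp * sqExp + (Exp.var 10).mod sqExp).eval τ =
          (x.m * (x.n * x.n) + q % (x.n * x.n) : ℕ) := by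
        rw [Exp.eval_add, Exp.eval_mul, Exp.eval_mod, Exp.eval_var, hc, eval_sqExp h,
          eval_mExp h]
        push_cast
        rfl
      have hlt : x.m * (x.n * x.n) + q % (x.n * x.n) < x.layer := by
        have := Nat.mod_lt q hsq
        omega
      rw [blockExp, Exp.eval_add, Exp.eval_mul, eval_get_of_eq 6 ha,
        eval_incExp h hj (eval_rowExp h hc), eval_incExp h hj (eval_colExp h hc), hread,
        h6 _ hlt, lapTable_last, minorTable_of_lt hq, block])
    (x.le_bound (by
      have := x.layer_le
      have := x.size_pow_le (i := 3) (by norm_num)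
      have : 1 ≤ (x.size + 1) ^ 4 := Nat.one_le_pow _ _ (by omega)
      omega))
    (fun i hi => x.bitLen_minorTable_le (by rw [Nat.div_eq_of_lt hi]; exact x.n_pos))
  exact ⟨_, t, ht, htb, hr, fun r hr' => by rw [filled_old (by norm_num) hr', h7 r hr'],
    fun r hr' => filled_new (by norm_num) hr'⟩

def orderExp : Exp := .var 11 / layerExp

/-- The beginning of the current matrix. -/
def originExp : Exp :=
  orderExp * layerExp + (Exp.var 11 / sqExp).mod (mExp + .const 1) * sqExp

def minorExp (i l : Exp) : Exp :=
  .get 7 (nExp + .const 1 + layerExp + (originExp + (i * nExp + l)))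

def stepExp : Exp :=
  (minorExp orderExp orderExp * .get 7 (nExp + .const 1 + layerExp + .var 11) -
      minorExp (rowExp 11) orderExp * minorExp orderExp (colExp 11)) /
    .get 7 (originExp + orderExp * (nExp + .const 1))

/-- Layer 0 already contains the minors of order 1, so n - 2 more layers reach order n - 1. -/
def stepProg : Prog := fill 7 11 ((nExp - .const 2) * layerExp)
  (nExp + .const 1 + layerExp + layerExp) stepExp

theorem eval_stepExp {τ : State} (h : ∀ a < 4, ∀ i, τ a i = x.input a i) {q : ℕ}
    (hq : q / x.layer < x.n) (hc : τ 11 0 = q)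
    (h1 : ∀ r < x.n + 1 + x.layer, τ 7 r = 1)
    (hT : ∀ r < x.layer + q, τ 7 (x.n + 1 + x.layer + r) = x.minorTable r) :
    stepExp.eval τ = x.minorTable (x.layer + q) := by
  have hn := x.n_pos
  have hj : q / (x.n * x.n) % (x.m + 1) ≤ x.m := Nat.lt_succ_iff.1 (Nat.mod_lt _ x.m.succ_pos)
  have hk : orderExp.eval τ = (q / x.layer : ℕ) := by
    rw [orderExp, Exp.eval_div, Exp.eval_var, hc, eval_layerExp h, Int.natCast_ediv]
  have hkq : q / x.layer * x.layer ≤ q := Nat.div_mul_le_self _ _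
  have ho : originExp.eval τ =
      (q / x.layer * x.layer + q / (x.n * x.n) % (x.m + 1) * (x.n * x.n) : ℕ) := by
    rw [originExp, Exp.eval_add, Exp.eval_mul, hk, eval_layerExp h, Exp.eval_mul, Exp.eval_mod,
      Exp.eval_div, Exp.eval_var, hc, eval_sqExp h, Exp.eval_add, eval_mExp h, Exp.eval_const]
    push_cast
    rfl
  have hm : ∀ {i l : Exp} {i' l' : ℕ}, i.eval τ = i' → l.eval τ = l' → i' < x.n → l' < x.n →
      (minorExp i l).eval τ =
        borderedMinor (x.block (q / (x.n * x.n) % (x.m + 1))) (q / x.layer) i' l' := by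
    intro i l i' l' hi hl hi' hl'
    have ha : (nExp + .const 1 + layerExp + (originExp + (i * nExp + l))).eval τ =
        (x.n + 1 + x.layer + (q / x.layer * x.layer +
          q / (x.n * x.n) % (x.m + 1) * (x.n * x.n) + (i' * x.n + l')) : ℕ) := by
      simp only [Exp.eval_add, Exp.eval_mul, Exp.eval_const, ho, hi, hl, eval_nExp h,
        eval_layerExp h]
      push_cast
      rfl
    -- The matrix being read lies in layer `q / x.layer`, which ends no later than position `x.layer
    -- + q` and is therefore complete.
    have hlt := x.index_lt hj hi' hl'
    rw [minorExp, eval_get_of_eq 7 ha, hT _ (by omega), x.minorTable_index hj hi' hl']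
  have hself : (nExp + .const 1 + layerExp + Exp.var 11).eval τ =
      (x.n + 1 + x.layer + q : ℕ) := by
    simp only [Exp.eval_add, Exp.eval_var, Exp.eval_const, hc, eval_nExp h, eval_layerExp h]
    push_cast
    rfl
  have hp : (originExp + orderExp * (nExp + .const 1)).eval τ =
      (q / x.layer * x.layer + q / (x.n * x.n) % (x.m + 1) * (x.n * x.n) +
        q / x.layer * (x.n + 1) : ℕ) := by
    simp only [Exp.eval_add, Exp.eval_mul, Exp.eval_const, hk, ho, eval_nExp h]
    push_cast
    rfl
  have hlay : 0 < x.layer := Nat.mul_pos x.m.succ_pos (Nat.mul_pos hn hn)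
  rw [stepExp, Exp.eval_div, Exp.eval_sub, Exp.eval_mul, Exp.eval_mul, hm hk hk hq hq,
    hm (eval_rowExp h hc) hk (Nat.mod_lt _ hn) hq, hm hk (eval_colExp h hc) hq (Nat.mod_lt _ hn),
    eval_get_of_eq 7 hself, eval_get_of_eq 7 hp, hT q (by omega),
    x.pivot_eq h1 hT hq (by omega) hj, minorTable_add_layer x hq]

theorem exec_stepProg {σ : State} (hσ : x.Ready 11 σ)
    (h1 : ∀ r < x.n + 1 + x.layer, σ 7 r = 1)
    (hT : ∀ r < x.layer, σ 7 (x.n + 1 + x.layer + r) = x.minorTable r) :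
    ∃ τ t, Exec stepProg σ τ t ∧
    t ≤ fillWeight 11 ((nExp - .const 2) * layerExp) (nExp + .const 1 + layerExp + layerExp)
      stepExp * x.bound ^ 2 ∧
    x.Ready 12 τ ∧ ∀ j ≤ x.m, τ 7 ((x.n - 1) * x.layer + j * (x.n * x.n) +
      (x.n - 1) * (x.n + 1)) = leadingMinor (x.block j) (x.n - 1) := by
  have hn := x.n_pos
  have hlay : 0 < x.layer := Nat.mul_pos x.m.succ_pos (Nat.mul_pos hn hn)
  have hread1 : ∀ q, ∀ r < x.n + 1 + x.layer,
      filled σ 7 11 (x.n + 1 + x.layer + x.layer) (fun i => x.minorTable (x.layer + i)) q 7 r =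
        1 := by
    intro q r hr
    rw [filled_old (by norm_num) (by omega), h1 r hr]
  have hreadT : ∀ q, ∀ r < x.layer + q,
      filled σ 7 11 (x.n + 1 + x.layer + x.layer) (fun i => x.minorTable (x.layer + i)) q 7
        (x.n + 1 + x.layer + r) = x.minorTable r := by
    intro q r hr
    by_cases h : r < x.layer
    · rw [filled_old (by norm_num) (by omega), hT r h]
    · obtain ⟨i, rfl⟩ := Nat.exists_eq_add_of_le (not_lt.1 h)
      rw [← Nat.add_assoc]
      exact filled_new (by norm_num) (by omega)
  have hdiv : ∀ q < (x.n - 2) * x.layer, q / x.layer < x.n - 2 := fun q hq =>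
    Nat.div_lt_of_lt_mul (by rwa [mul_comm])
  obtain ⟨t, ht, htb, hr⟩ := hσ.exec_fill (a := 7) (N := (nExp - .const 2) * layerExp)
    (base := nExp + .const 1 + layerExp + layerExp) (E := stepExp) (by norm_num) (by norm_num)
    (k := (x.n - 2) * x.layer) (b := x.n + 1 + x.layer + x.layer)
    (z := ((x.n : ℤ) - 2) * x.layer) (f := fun i => x.minorTable (x.layer + i))
    (by
      by_cases h2 : 2 ≤ x.n
      · have : ((x.n : ℤ) - 2) * x.layer = ((x.n - 2) * x.layer : ℕ) := by
          push_cast [h2]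
          rfl
        rw [this, Int.toNat_natCast]
      -- For n = 1 the integer limit is negative, so no round is run; the required minor of order 0
      -- is then read from the prefix of ones.
      · have h3 : x.n = 1 := by omega
        rw [h3]
        have : ((1 : ℕ) - 2 : ℤ) * x.layer ≤ 0 := by push_cast; omega
        rw [Int.toNat_of_nonpos this]
        simp)
    (fun τ h => by
      rw [Exp.eval_mul, Exp.eval_sub, eval_layerExp h, eval_nExp h, Exp.eval_const])
    (fun τ h => by
      rw [Exp.eval_add, Exp.eval_add, Exp.eval_add, eval_layerExp h, eval_nExp h,
        Exp.eval_const]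
      push_cast
      ring)
    (fun q hq h => eval_stepExp h (by have := hdiv q hq; omega) filled_counter (hread1 q)
      (hreadT q))
    (x.le_bound (by
      have h2 := x.layer_le
      have h3 := x.n_add_one_le_size
      have h4 : (x.n - 2) * x.layer ≤ (x.size + 1) * (x.size + 1) ^ 3 :=
        Nat.mul_le_mul (by omega) h2
      have : 1 ≤ (x.size + 1) ^ 4 := Nat.one_le_pow _ _ (by omega)
      rw [← pow_succ', show 3 + 1 = 4 from rfl] at h4
      omega))
    (fun i hi => x.bitLen_minorTable_le (by
      have := hdiv i hi
      rw [Nat.add_div_left _ hlay]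
      omega))
  refine ⟨_, t, ht, htb, hr, fun j hj => x.pivot_eq (hread1 _) (hreadT _) (by omega) ?_ hj⟩
  obtain h | h := Nat.lt_or_ge x.n 2
  · rw [show x.n - 1 = 0 by omega]
    omega
  · rw [show x.n - 1 = x.n - 2 + 1 by omega, Nat.add_mul]
    omega

/-- Computes the principal minors for all `j ≤ m`. -/
def eliminationProg : Prog := .seq lapProg (.seq onesProg (.seq blockProg stepProg))

theorem exec_eliminationProg : ∃ C : ℕ, ∀ x : SCGInstance, ∃ τ t,
    Exec eliminationProg x.input τ t ∧ t ≤ C * x.bound ^ 2 ∧ x.Ready 12 τ ∧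
    ∀ j ≤ x.m, τ 7 ((x.n - 1) * x.layer + j * (x.n * x.n) + (x.n - 1) * (x.n + 1)) =
      leadingMinor (x.block j) (x.n - 1) := by
  refine ⟨fillWeight 8 (mExp * sqExp) sqExp lapExp +
    (fillWeight 9 (layerExp + nExp + .const 1) (.const 0) (.const 1) +
      (fillWeight 10 layerExp (nExp + .const 1 + layerExp) blockExp +
        fillWeight 11 ((nExp - .const 2) * layerExp) (nExp + .const 1 + layerExp + layerExp)
          stepExp + 1) + 1) + 1, fun x => ?_⟩
  obtain ⟨τ₁, t₁, e₁, b₁, r₁, h₁⟩ := exec_lapProg x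
  obtain ⟨τ₂, t₂, e₂, b₂, r₂, h₂, h₂'⟩ := exec_onesProg r₁ h₁
  obtain ⟨τ₃, t₃, e₃, b₃, r₃, h₃, h₃'⟩ := exec_blockProg r₂ h₂ h₂'
  obtain ⟨τ₄, t₄, e₄, b₄, r₄, h₄⟩ := exec_stepProg r₃ h₃ h₃'
  refine ⟨τ₄, _, .seq e₁ (.seq e₂ (.seq e₃ e₄)), ?_, r₄, h₄⟩
  have hB : 1 ≤ x.bound ^ 2 := Nat.one_le_pow _ _ r₁.bounded.one_le
  simp only [Nat.add_mul]
  omega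

/-! ### The output -/

/-- The minor for the `j`-th underlying edge. -/
def resultExp (j : Exp) : Exp :=
  .get 7 ((nExp - .const 1) * layerExp + j * sqExp + (nExp - .const 1) * (nExp + .const 1))

theorem eval_resultExp {τ : State} (h : ∀ a < 4, ∀ i, τ a i = x.input a i) {j : Exp} {j' : ℕ}
    (hj : j.eval τ = j') : (resultExp j).eval τ =
      τ 7 ((x.n - 1) * x.layer + j' * (x.n * x.n) + (x.n - 1) * (x.n + 1)) := by
  refine eval_get_of_eq 7 ?_
  have hn : (x.n : ℤ) - 1 = (x.n - 1 : ℕ) := by have := x.n_pos; omega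
  simp only [Exp.eval_add, Exp.eval_mul, Exp.eval_sub, Exp.eval_const, eval_nExp h,
    eval_layerExp h, eval_sqExp h, hj, hn]
  push_cast
  rfl

/-- A loop over the underlying edges that writes to array `a` a function of the number of
spanning trees and the minor of the edge. -/
theorem exec_output {a c : ℕ} (ha : 4 ≤ a) (ha' : a < 7) (hc : 12 ≤ c) {E : Exp} {σ : State}
    (hσ : x.Ready c σ)
    (h7 : ∀ j ≤ x.m, σ 7 ((x.n - 1) * x.layer + j * (x.n * x.n) + (x.n - 1) * (x.n + 1)) =
      leadingMinor (x.block j) (x.n - 1)) {f : ℕ → ℤ}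
    (hE : ∀ τ : State, (∀ a < 4, ∀ i, τ a i = x.input a i) →
      (resultExp mExp).eval τ = x.G.treeCount → ∀ j < x.m,
      τ c 0 = j → (resultExp (.var c)).eval τ = leadingMinor (x.block j) (x.n - 1) →
      E.eval τ = f j)
    (hf : ∀ j < x.m, bitLen (f j) ≤ x.bound) :
    ∃ τ t, Exec (fill a c mExp (.const 0) E) σ τ t ∧
      t ≤ fillWeight c mExp (.const 0) E * x.bound ^ 2 ∧ x.Ready (c + 1) τ ∧
      (∀ j ≤ x.m, τ 7 ((x.n - 1) * x.layer + j * (x.n * x.n) + (x.n - 1) * (x.n + 1)) =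
        leadingMinor (x.block j) (x.n - 1)) ∧
      (∀ j < x.m, τ a j = f j) ∧ ∀ d, d ≠ a → d ≠ c → τ d = σ d := by
  have h7' : ∀ q, ∀ j ≤ x.m, filled σ a c 0 f q 7 ((x.n - 1) * x.layer + j * (x.n * x.n) +
      (x.n - 1) * (x.n + 1)) = leadingMinor (x.block j) (x.n - 1) := by
    intro q j hj
    rw [filled_of_ne (by omega) (by omega), h7 j hj]
  obtain ⟨t, ht, htb, hr⟩ := hσ.exec_fill (a := a) (N := mExp) (base := .const 0) (E := E)
    ha (by omega) (k := x.m) (b := 0) (z := x.m) (f := f) (Int.toNat_natCast _)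
    (fun τ h => eval_mExp h) (fun τ h => rfl)
    (fun q hq h => by
      refine hE _ h ?_ q hq filled_counter ?_
      · rw [eval_resultExp h (eval_mExp h), h7' q _ le_rfl, leadingMinor_block_m]
      · rw [eval_resultExp h (j := .var c) (j' := q) filled_counter, h7' q _ hq.le])
    (x.le_bound (by
      have := x.m_add_two_le_size
      have h1 := x.size_pow_le (i := 1) (by norm_num)
      rw [pow_one] at h1
      omega)) hf
  refine ⟨_, t, ht, htb, hr, h7' _, fun j hj => ?_, fun d hd hd' => funext fun i =>
    filled_of_ne hd hd' i⟩
  have := filled_new (σ := σ) (a := a) (c := c) (b := 0) (f := f) (by omega) hj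
  rwa [Nat.zero_add] at this

theorem bitLen_le_bound_of_abs_le (x : SCGInstance) {z : ℤ}
    (h : |z| ≤ (x.size + 3) * 2 ^ (3 * x.size ^ 2)) : bitLen z ≤ x.bound := by
  refine x.bitLen_le_bound (h.trans ?_)
  have h1 : x.size + 3 ≤ 2 ^ (x.size + 2) := Nat.lt_two_pow_self (n := x.size + 2)
  rw [add_assoc, pow_add, mul_comm]
  exact mul_le_mul_of_nonneg_left (by exact_mod_cast h1) (by positivity)

theorem treeCount_le (x : SCGInstance) : (x.G.treeCount : ℤ) ≤ 2 ^ (3 * x.size ^ 2) := by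
  rw [← leadingMinor_block_m]
  exact (le_abs_self _).trans (x.abs_leadingMinor_block_le _)

theorem hollerValue_eq (j : Fin x.m) (k : Fin (x.G.mult (x.pair j))) :
    (Game.hollerValue x.G.scg ⟨x.pair j, k⟩ : ℤ) =
      leadingMinor (x.block j) (x.n - 1) - x.G.treeCount := by
  rw [x.leadingMinor_block j k]
  have := x.G.hollerValue_add_treeCount_deleteEdge ⟨x.pair j, k⟩
  omega

theorem abs_sub_treeCount_le (x : SCGInstance) (j : ℕ) :
    |leadingMinor (x.block j) (x.n - 1) - x.G.treeCount| ≤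
      (x.size + 3) * 2 ^ (3 * x.size ^ 2) := by
  have h1 := x.abs_leadingMinor_block_le j
  have h2 := x.treeCount_le
  have h3 : (0 : ℤ) ≤ x.size * 2 ^ (3 * x.size ^ 2) := by positivity
  rw [abs_le] at h1 ⊢
  constructor <;> nlinarith

theorem solvableInPolyTime_of_bound {correct : SCGInstance → State → Prop} (p : Prog)
    (h : ∃ C : ℕ, ∀ x : SCGInstance, ∃ τ t, Exec p x.input τ t ∧ t ≤ C * x.bound ^ 2 ∧
      correct x τ) :
    SolvableInPolyTime SCGInstance.input SCGInstance.size correct := by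
  obtain ⟨C, h⟩ := h
  refine ⟨p, Polynomial.C C * (10 * (Polynomial.X + 1) ^ 4) ^ 2, fun x => ?_⟩
  obtain ⟨τ, t, e, b, hc⟩ := h x
  refine ⟨τ, t, e, b.trans (le_of_eq ?_), hc⟩
  simp [bound]

def treeCountsProg : Prog :=
  .seq eliminationProg (.seq
    (fill 5 12 mExp (.const 0) (.const 2 * resultExp mExp - resultExp (.var 12)))
    (.assign 4 (.const 0) (resultExp mExp)))

theorem solvable_treeCounts :
    SolvableInPolyTime SCGInstance.input SCGInstance.size (fun x => x.TreeCountsIn) := by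
  obtain ⟨C, hC⟩ := exec_eliminationProg
  refine solvableInPolyTime_of_bound treeCountsProg
    ⟨C + (fillWeight 12 mExp (.const 0) (.const 2 * resultExp mExp - resultExp (.var 12)) +
      ((Exp.const 0).weight + (resultExp mExp).weight + 1) + 1) + 1, fun x => ?_⟩
  obtain ⟨τ₁, t₁, e₁, b₁, r₁, h₁⟩ := hC x
  obtain ⟨τ₂, t₂, e₂, b₂, r₂, h₂, h₂', -⟩ := exec_output (a := 5) (c := 12) (by norm_num)
    (by norm_num) le_rfl (E := .const 2 * resultExp mExp - resultExp (.var 12)) r₁ h₁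
    (f := fun j => 2 * x.G.treeCount - leadingMinor (x.block j) (x.n - 1))
    (fun τ h ht j hj hc hr => by
      rw [Exp.eval_sub, Exp.eval_mul, Exp.eval_const, ht, hr])
    (fun j hj => x.bitLen_le_bound_of_abs_le (by
      have h1 := x.abs_leadingMinor_block_le j
      have h2 := x.treeCount_le
      have h3 : (0 : ℤ) ≤ x.size * 2 ^ (3 * x.size ^ 2) := by positivity
      rw [abs_le] at h1 ⊢
      constructor <;> nlinarith))
  have hres : (resultExp mExp).eval τ₂ = x.G.treeCount := by
    rw [eval_resultExp r₂.input (eval_mExp r₂.input), h₂ _ le_rfl, leadingMinor_block_m]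
  refine ⟨_, _, .seq e₁ (.seq e₂ (.assign τ₂ 4 (.const 0) (resultExp mExp))), ?_, ?_, ?_⟩
  · have hB : 1 ≤ x.bound ^ 2 := Nat.one_le_pow _ _ r₁.bounded.one_le
    have hBB : x.bound ≤ x.bound ^ 2 := Nat.le_self_pow (by norm_num) _
    have c1 := (Exp.cost_le r₂.bounded (.const 0)).trans (Nat.mul_le_mul_left _ hBB)
    have c2 := (Exp.cost_le r₂.bounded (resultExp mExp)).trans (Nat.mul_le_mul_left _ hBB)
    simp only [Nat.add_mul]
    omega
  · rw [hres]
    simp [State.write]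
  · intro j k
    rw [State.write, Function.update_of_ne (by norm_num), h₂' j j.2, x.leadingMinor_block j k]
    ring

def hollerProg : Prog :=
  .seq eliminationProg
    (fill 4 12 mExp (.const 0) (resultExp (.var 12) - resultExp mExp))

theorem exec_hollerProg : ∃ C : ℕ, ∀ x : SCGInstance, ∃ τ t,
    Exec hollerProg x.input τ t ∧ t ≤ C * x.bound ^ 2 ∧ x.Ready 13 τ ∧
    (∀ j ≤ x.m, τ 7 ((x.n - 1) * x.layer + j * (x.n * x.n) + (x.n - 1) * (x.n + 1)) =
      leadingMinor (x.block j) (x.n - 1)) ∧ x.ValuesIn (Game.hollerValue x.G.scg) τ := by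
  obtain ⟨C, hC⟩ := exec_eliminationProg
  refine ⟨C + fillWeight 12 mExp (.const 0) (resultExp (.var 12) - resultExp mExp) + 1,
    fun x => ?_⟩
  obtain ⟨τ₁, t₁, e₁, b₁, r₁, h₁⟩ := hC x
  obtain ⟨τ₂, t₂, e₂, b₂, r₂, h₂, h₂', -⟩ := exec_output (a := 4) (c := 12) (by norm_num)
    (by norm_num) le_rfl (E := resultExp (.var 12) - resultExp mExp) r₁ h₁
    (f := fun j => leadingMinor (x.block j) (x.n - 1) - x.G.treeCount)
    (fun τ h ht j hj hc hr => by rw [Exp.eval_sub, ht, hr])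
    (fun j hj => x.bitLen_le_bound_of_abs_le (x.abs_sub_treeCount_le j))
  refine ⟨τ₂, _, .seq e₁ e₂, ?_, r₂, h₂, fun j k => ?_⟩
  · have hB : 1 ≤ x.bound ^ 2 := Nat.one_le_pow _ _ r₁.bounded.one_le
    simp only [Nat.add_mul]
    omega
  · rw [h₂' j j.2, hollerValue_eq]

theorem solvable_hollerValue :
    SolvableInPolyTime SCGInstance.input SCGInstance.size
      (fun x => x.ValuesIn (Game.hollerValue x.G.scg)) := by
  obtain ⟨C, hC⟩ := exec_hollerProg
  refine solvableInPolyTime_of_bound hollerProg ⟨C, fun x => ?_⟩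
  obtain ⟨τ, t, e, b, -, -, hv⟩ := hC x
  exact ⟨τ, t, e, b, hv⟩

def indexProg : Prog :=
  .seq hollerProg
    (fill 5 13 mExp (.const 0) (resultExp mExp * (nExp - .const 1)))

/-- Both indices have this form, so one program serves them: the Holler values are the numerators,
and the denominator is the same for all edges. -/
theorem solvable_index {f : ∀ x : SCGInstance, x.G.Edge → ℚ}
    (hf : ∀ x e, f x e = (Game.hollerValue x.G.scg e : ℚ) /
      (x.G.treeCount * (Fintype.card (Fin x.n) - 1 : ℕ))) :
    SolvableInPolyTime SCGInstance.input SCGInstance.size (fun x => x.RationalsIn (f x)) := by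
  obtain ⟨C, hC⟩ := exec_hollerProg
  refine solvableInPolyTime_of_bound indexProg
    ⟨C + fillWeight 13 mExp (.const 0) (resultExp mExp * (nExp - .const 1)) + 1, fun x => ?_⟩
  obtain ⟨τ₁, t₁, e₁, b₁, r₁, h₁, hv⟩ := hC x
  have hn : (x.n : ℤ) - 1 = (x.n - 1 : ℕ) := by have := x.n_pos; omega
  obtain ⟨τ₂, t₂, e₂, b₂, r₂, h₂, h₂', h₂''⟩ := exec_output (a := 5) (c := 13) (by norm_num)
    (by norm_num) (by norm_num) (E := resultExp mExp * (nExp - .const 1)) r₁ h₁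
    (f := fun _ => x.G.treeCount * (x.n - 1 : ℕ))
    (fun τ h ht j hj hc hr => by
      rw [Exp.eval_mul, Exp.eval_sub, ht, eval_nExp h, Exp.eval_const, hn])
    (fun j hj => x.bitLen_le_bound_of_abs_le (by
      have h1 := x.treeCount_le
      have h2 : ((x.n - 1 : ℕ) : ℤ) ≤ x.size + 3 := by
        have := x.n_add_one_le_size
        omega
      rw [abs_of_nonneg (by positivity), mul_comm]
      exact mul_le_mul h2 h1 (by positivity) (by positivity)))
  refine ⟨τ₂, _, .seq e₁ e₂, ?_, fun j k => ⟨?_, ?_⟩⟩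
  · have hB : 1 ≤ x.bound ^ 2 := Nat.one_le_pow _ _ r₁.bounded.one_le
    simp only [Nat.add_mul]
    omega
  · rw [h₂' j j.2]
    -- The j-th edge has two distinct ends, which keeps the factor n - 1 positive.
    have h3 : 1 < x.n := by
      have h4 : x.src j ≠ x.tgt j :=
        x.G.graph.ne_of_adj (x.enum.mapsTo (Set.mem_univ j))
      have := Fin.val_ne_of_ne h4
      omega
    have := x.treeCount_pos
    have h5 : 0 < x.n - 1 := by omega
    positivity
  · rw [h₂' j j.2, h₂'' 4 (by norm_num) (by norm_num), hv j k, hf, Fintype.card_fin]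
    push_cast
    rfl

end SCGInstance

/-! ### The proposition -/

theorem mainTheorem7 :
    (∀ (V : Type*) [Fintype V] [DecidableEq V] (G : Multigraph V), G.Connected →
      (∀ u w : V, G.laplacian.adjugate u w = (G.treeCount : ℤ)) ∧
      (∀ e : G.Edge,
        (G.IsBridge e → Game.hollerValue G.scg e = G.treeCount) ∧
        (¬ G.IsBridge e → (Game.hollerValue G.scg e : ℤ) =
          (G.treeCount : ℤ) - ((G.deleteEdge e).treeCount : ℤ))) ∧
      (∀ S ∈ Game.minimalWinning G.scg, S.card + 1 = Fintype.card V) ∧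
      (∀ e : G.Edge, Game.hollerIndex G.scg e = Game.deeganPackelIndex G.scg e)) ∧
    RAM.SolvableInPolyTime SCGInstance.input SCGInstance.size
      (fun x => x.TreeCountsIn) ∧
    RAM.SolvableInPolyTime SCGInstance.input SCGInstance.size
      (fun x => x.ValuesIn (Game.hollerValue x.G.scg)) ∧
    RAM.SolvableInPolyTime SCGInstance.input SCGInstance.size
      (fun x => x.RationalsIn (Game.hollerIndex x.G.scg)) ∧
    RAM.SolvableInPolyTime SCGInstance.input SCGInstance.size
      (fun x => x.RationalsIn (Game.deeganPackelIndex x.G.scg)) := by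
  refine ⟨fun V _ _ G hG => ⟨Multigraph.adjugate_laplacian hG, fun e => ⟨fun he => ?_,
    fun _ => ?_⟩, fun S hS => (Multigraph.mem_minimalWinning_scg.1 hS).card_add_one,
    fun e => ?_⟩, SCGInstance.solvable_treeCounts, SCGInstance.solvable_hollerValue,
    SCGInstance.solvable_index fun x e => x.G.hollerIndex_scg e,
    SCGInstance.solvable_index fun x e => x.G.deeganPackelIndex_scg e⟩
  · rw [← G.hollerValue_add_treeCount_deleteEdge e,
      Multigraph.treeCount_eq_zero_of_not_connected he, add_zero]
  · have := G.hollerValue_add_treeCount_deleteEdge e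
    omega
  · rw [G.hollerIndex_scg, G.deeganPackelIndex_scg]
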